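/- Let $n\ge 3$ be an integer and $0<m<\frac{n-2}{n}$, and put $\gamma_1=\frac{n-2}{m}-\frac{2}{1-m}=\frac{n-2-nm}{m(1-m)}>0$. **Profiles.** For $\beta<0$ and $A>0$ put $\alpha=\frac{2\beta}{1-m}$, $\widetilde\beta=-\beta$. There is exactly one positive $f=f_{\beta,A}\in C^2((0,\infty))$ with $$\frac{n-1}{m}\Big((f^m)_{rr}+\frac{n-1}{r}(f^m)_r\Big)+\alpha f+\beta r f_r=0\quad\text{in }(0,\infty),\qquad \lim_{r\to\infty}r^{\frac{n-2}{m}}f(r)=A.$$ For $\lambda>0$ let $f_\lambda(r)=\lambda^{\frac{2}{1-m}}f_{\beta,1}(\lambda r)$. **Constants.** There is exactly one positive $g\in C^2((0,\infty))$ with $$\frac{n-1}{m}\Big((g^m)_{rr}+\frac{n-1}{r}(g^m)_r\Big)+r^{\frac{n-2}{m}-n-2}\big(\gamma_1 g+ r g_r\big)=0\quad\text{in }(0,\infty),\qquad \lim_{r\to0^+}g(r)=1,$$ and, with $\widetilde w(s)=e^{(1-m)\gamma_1 s}g(e^s)^{1-m}$, the limit $$K:=\lim_{s\to\infty}\Big(\widetilde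 w(s)-\frac{2(n-1)(n-2-nm)}{1-m}\,s-\frac{(n-1)(n-2-(n+2)m)}{1-m}\log s\Big)\in\mathbb R$$ exists. Let $$a_2=\frac{2(1-2m)(n-1)(n-2-nm)}{(1-m)^2}+\frac{(n-1)(n-2-(n+2)m)^2}{(1-m)^2}-\frac{n-2-(n+2)m}{1-m}K,$$ $$a_1=\frac{(n-2-(n+2)m)^2}{4(n-2-nm)^2}-\frac{(1-m)^2a_2}{4(n-1)(n-2-nm)^2},\qquad K_0=\frac{(1-m)K}{2(n-1)(n-2-nm)},$$ $$a_3(A,\widetilde\beta)=a_1+\frac{n-2-(n+2)m}{2(n-2-nm)\gamma_1}\log\big(A\widetilde\beta^{\frac1{1-m}}\big).$$ **Expansions.** For all $\beta<0$ and $A>0$, as $r\to0^+$, $$f_{\beta,A}^{1-m}(r)=\frac{2(n-1)(n-2-nm)}{(1-m)|\beta|r^2}\Big\{\log r^{-1}+\frac{n-2-(n+2)m}{2(n-2-nm)}\log(\log r^{-1})+K_0+\frac1{\gamma_1}\log A+\frac{m}{n-2-nm}\log|\beta|+\frac{a_3(A,\widetilde\beta)}{\log r^{-1}}+\frac{(n-2-(n+2)m)^2}{4(n-2-nm)^2}\cdot\frac{\log(\log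 r^{-1})}{\log r^{-1}}+o\Big(\frac1{\log r^{-1}}\Big)\Big\},$$ and for all $\beta<0$ and $\lambda>0$, as $r\to0^+$, $$f_{\lambda}^{1-m}(r)=\frac{2(n-1)(n-2-nm)}{(1-m)|\beta|r^2}\Big\{\log r^{-1}+\frac{n-2-(n+2)m}{2(n-2-nm)}\log(\log r^{-1})+K_0-\log\lambda+\frac{m}{n-2-nm}\log|\beta|+\frac{a_3(\lambda^{-\gamma_1},\widetilde\beta)}{\log r^{-1}}+\frac{(n-2-(n+2)m)^2}{4(n-2-nm)^2}\cdot\frac{\log(\log r^{-1})}{\log r^{-1}}+o\Big(\frac1{\log r^{-1}}\Big)\Big\}.$$ -/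

import Mathlib

open Real Set Filter Topology Asymptotics

noncomputable section

namespace FastDiffusion

/-- The quantity `γ₁ = (n-2)/m - 2/(1-m)`. -/
def gamma1 (n : ℕ) (m : ℝ) : ℝ := ((n : ℝ) - 2) / m - 2 / (1 - m)

/-- The radial part `(u_rr + ((n-1)/r) u_r)(r)` of the Laplacian in dimension `n`. -/
def radialLaplacian (n : ℕ) (u : ℝ → ℝ) (r : ℝ) : ℝ :=
  deriv (deriv u) r + ((n : ℝ) - 1) / r * deriv u r

/-- `f` is a positive classical solution on `(0,∞)` of
`((n-1)/m) ((f^m)_rr + ((n-1)/r) (f^m)_r) + α f + β r f_r = 0`, with `α = 2β/(1-m)`, such that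
`r^((n-2)/m) f(r) → A` as `r → ∞`. Only the values of `f` on `(0,∞)` matter. -/
structure IsProfile (n : ℕ) (m β A : ℝ) (f : ℝ → ℝ) : Prop where
  smooth : ContDiffOn ℝ 2 f (Ioi 0)
  pos : ∀ r, 0 < r → 0 < f r
  ode : ∀ r, 0 < r →
    ((n : ℝ) - 1) / m * radialLaplacian n (fun x => f x ^ m) r
      + 2 * β / (1 - m) * f r + β * r * deriv f r = 0
  growth : Tendsto (fun r => r ^ (((n : ℝ) - 2) / m) * f r) atTop (𝓝 A)

/-- `f` is, as a function on `(0,∞)`, the unique profile `f_{β,A}`. -/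
def IsUniqueProfile (n : ℕ) (m β A : ℝ) (f : ℝ → ℝ) : Prop :=
  IsProfile n m β A f ∧ ∀ f', IsProfile n m β A f' → EqOn f' f (Ioi 0)

/-- `g` is a positive classical solution on `(0,∞)` of
`((n-1)/m) ((g^m)_rr + ((n-1)/r) (g^m)_r) + r^((n-2)/m - n - 2) (α' g + β' r g_r) = 0`
with `α' = γ₁ β'`, which extends continuously to `0` with the value `η`.
(Here `β'` and `α'` are written with a tilde in the mathematical text.) -/
structure IsInvertedProfile (n : ℕ) (m βt η : ℝ) (g : ℝ → ℝ) : Prop where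
  smooth : ContDiffOn ℝ 2 g (Ioi 0)
  pos : ∀ r, 0 < r → 0 < g r
  ode : ∀ r, 0 < r →
    ((n : ℝ) - 1) / m * radialLaplacian n (fun x => g x ^ m) r
      + r ^ (((n : ℝ) - 2) / m - n - 2)
        * (gamma1 n m * βt * g r + βt * r * deriv g r) = 0
  initial : Tendsto g (𝓝[>] 0) (𝓝 η)

/-- `g` is, as a function on `(0,∞)`, the unique inverted profile `g_{β',η}`. -/
def IsUniqueInvertedProfile (n : ℕ) (m βt η : ℝ) (g : ℝ → ℝ) : Prop :=
  IsInvertedProfile n m βt η g ∧ ∀ g', IsInvertedProfile n m βt η g' → EqOn g' g (Ioi 0)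

/-- `w(e^s)`, where `w(r) = r^((1-m) α'/β') g(r)^(1-m)` and `α'/β' = γ₁`. -/
def wTilde (n : ℕ) (m : ℝ) (g : ℝ → ℝ) (s : ℝ) : ℝ :=
  (exp s) ^ ((1 - m) * gamma1 n m) * g (exp s) ^ (1 - m)

/-- `h(s) = w(e^s) - (2(n-1)(n-2-nm)/((1-m)β')) s`. -/
def hFun (n : ℕ) (m βt : ℝ) (g : ℝ → ℝ) (s : ℝ) : ℝ :=
  wTilde n m g s - 2 * ((n : ℝ) - 1) * (n - 2 - n * m) / ((1 - m) * βt) * s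

/-- `h₁(s) = h(s) - ((n-1)(n-2-(n+2)m)/((1-m)β')) log s`. If `m = (n-2)/(n+2)`, then the
coefficient of `log s` is zero and `h₁ = h`. -/
def h1Fun (n : ℕ) (m βt : ℝ) (g : ℝ → ℝ) (s : ℝ) : ℝ :=
  hFun n m βt g s - ((n : ℝ) - 1) * (n - 2 - (n + 2) * m) / ((1 - m) * βt) * log s

/-- `K = K(η,β')` is the limit of `h₁(s)` as `s → ∞`, with `g = g_{β',η}`
(of `h(s)` in the case `m = (n-2)/(n+2)`, where the two agree). -/
def IsLimitConstant (n : ℕ) (m βt : ℝ) (g : ℝ → ℝ) (K : ℝ) : Prop :=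
  Tendsto (h1Fun n m βt g) atTop (𝓝 K)

/-- `a₂(η,β')` as a function of the value `K = K(η,β')` and of `β'`. -/
def a2 (n : ℕ) (m K βt : ℝ) : ℝ :=
  2 * (1 - 2 * m) * ((n : ℝ) - 1) * (n - 2 - n * m) / (1 - m) ^ 2
    + ((n : ℝ) - 1) * (n - 2 - (n + 2) * m) ^ 2 / (1 - m) ^ 2
    - ((n : ℝ) - 2 - (n + 2) * m) / (1 - m) * K * βt

/-- `a₁`, where `K = K(1,1)`. -/
def a1 (n : ℕ) (m K : ℝ) : ℝ :=
  ((n : ℝ) - 2 - (n + 2) * m) ^ 2 / (4 * ((n : ℝ) - 2 - n * m) ^ 2)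
    - (1 - m) ^ 2 * a2 n m K 1 / (4 * ((n : ℝ) - 1) * (n - 2 - n * m) ^ 2)

/-- `K₀`, where `K = K(1,1)`. -/
def K0 (n : ℕ) (m K : ℝ) : ℝ :=
  (1 - m) * K / (2 * ((n : ℝ) - 1) * (n - 2 - n * m))

/-- `a₃(A,β')`, where `K = K(1,1)`. -/
def a3 (n : ℕ) (m K A βt : ℝ) : ℝ :=
  a1 n m K
    + ((n : ℝ) - 2 - (n + 2) * m) / (2 * ((n : ℝ) - 2 - n * m) * gamma1 n m)
      * log (A * βt ^ (1 / (1 - m)))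

/-- The scaled function `f_λ(r) = λ^(2/(1-m)) f₁(λ r)`. -/
def scaled (m lam : ℝ) (f₁ : ℝ → ℝ) (r : ℝ) : ℝ :=
  lam ^ (2 / (1 - m)) * f₁ (lam * r)

/-- With `L = log r⁻¹`, as `r → 0⁺`,
`f(r)^(1-m) = (2(n-1)(n-2-nm)/((1-m)|β| r²)) { L + ((n-2-(n+2)m)/(2(n-2-nm))) log L
  + c + a / L + ((n-2-(n+2)m)²/(4(n-2-nm)²)) (log L) / L + o(1/L) }`. -/
def HasExpansionAtZero (n : ℕ) (m β c a : ℝ) (f : ℝ → ℝ) : Prop :=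
  ∃ ε : ℝ → ℝ, ε =o[𝓝[>] 0] (fun r => 1 / log r⁻¹) ∧
    ∀ᶠ r in 𝓝[>] 0,
      f r ^ (1 - m) =
        2 * ((n : ℝ) - 1) * (n - 2 - n * m) / ((1 - m) * |β| * r ^ 2) *
          (log r⁻¹
            + ((n : ℝ) - 2 - (n + 2) * m) / (2 * ((n : ℝ) - 2 - n * m)) * log (log r⁻¹)
            + c
            + a / log r⁻¹
            + ((n : ℝ) - 2 - (n + 2) * m) ^ 2 / (4 * ((n : ℝ) - 2 - n * m) ^ 2)
                * (log (log r⁻¹) / log r⁻¹)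
            + ε r)

end FastDiffusion

end

/-!
Both equations are radial, and an Emden–Fowler change of variables turns both into one and the same
autonomous equation. With `V(s) = (μ ρ^ν φ(ρ))^m` and `ρ = λ e^{σ s}`, where `σ = 1`,
`ν = γ₁` for the inverted profile `φ = g` and `σ = -1`, `ν = 2/(1-m)` for a profile `φ = f`, either
equation becomes
`V'' - (κ - a) V' - a κ V + k (V^p)' = 0`, `a = 2m/(1-m)`, `κ = mγ₁`, `k = m/(n-1)`, `p = 1/m`,
and for suitable constants `μ, λ` the limit condition on `φ` becomes `e^{-κs} V(s) → 1` as
`s → -∞`. The equation integrates once to the Liénard system `V' = (κ-a)V - kV^p + Y`,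
`Y' = aκV` (`IsOrbit`), whose linear part at the origin has the eigenvalues `κ > 0 > -a`; the
normalization singles out one orbit of the one-dimensional unstable manifold.
The change of variables is `EmdenParams.exists_hasDerivAt_emden`, an identity expressing the
residual of the `V`-equation as a positive multiple of the residual of the `φ`-equation, so that
solutions correspond in both directions. Hence every `f_{β,A}` and `g` come from a single orbit `V`.

*Uniqueness* (`IsOrbit.unique`). In the eigendirections `V + Y/κ` and `V - Y/a`, the difference of
two orbits, multiplied by `e^{-κs}`, tends to zero at `-∞` and its square `E` satisfies
`E' ≤ C e^{(p-1)κs} E`, whose coefficient is integrable at `-∞`; so `E = 0`.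

*Existence* (`exists_orbit`). In `x = e^{(p-1)κs}` and `u = e^{-κs} V` the problem is a Volterra
equation `u(x) = 1 - x ∫₀¹ K(t) u(xt)^p dt`. After truncating the power it is solved on all of
`[0,∞)` by a contraction in an exponentially weighted sup norm (`exists_volterra_solution`), and the
solution stays in `(0,1]`, where the truncation is inactive.

*Asymptotics* (`IsOrbit.exists_expansion`). `W = V^{p-1}` and `e = V'/V` satisfy
`W' = (p-1)We`, `e' = aκ + (κ-a)e - e² - kpWe`, and `W → ∞`. The last term is a strong damping, so
`θ = We` is slaved to `W`: `θ = θ₀ + θ₁/W + (θ₂ + o(1))/W²` (`riccati_expansion`, by repeated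
use of `tendsto_zero_of_damped`). Integrating `W' = (p-1)θ` gives the expansion of `W` up to
`o(1/s)` (`exists_expansion_of_deriv`). Since `f_{β,A}(r)^{1-m} = W(s)/(|β|r²)` with
`s = log r⁻¹ + log λ`, the expansions of `f_{β,A}` and `f_λ` follow by shifting the variable
(`tendsto_shifted_expansion`), the shift being `log λ = (1/γ₁) log (A|β|^{1/(1-m)})`.
-/

noncomputable section

namespace FastDiffusion

/-! ### Barriers and damped linear equations -/

/-- A function which is positive at `s₀` stays positive if its derivative is positive at every possible
first zero. -/
lemma pos_of_first_zero {f f' : ℝ → ℝ} {s₀ : ℝ} (hf : ∀ s, HasDerivAt f (f' s) s)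
    (h0 : 0 < f s₀)
    (h : ∀ s, s₀ < s → (∀ t ∈ Ico s₀ s, 0 < f t) → f s = 0 → 0 < f' s) :
    ∀ s, s₀ ≤ s → 0 < f s := by
  by_contra! hcon
  obtain ⟨s, hs, hfs⟩ := hcon
  have hcont : Continuous f := continuous_iff_continuousAt.2 fun s => (hf s).continuousAt
  set S : Set ℝ := {t | s₀ ≤ t ∧ f t ≤ 0} with hS
  have hSne : S.Nonempty := ⟨s, hs, hfs⟩
  have hSb : BddBelow S := ⟨s₀, fun t ht => ht.1⟩
  have hSc : IsClosed S :=
    (isClosed_le continuous_const continuous_id).inter (isClosed_le hcont continuous_const)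
  have hmem : sInf S ∈ S := hSc.csInf_mem hSne hSb
  set z := sInf S with hz
  have hbefore : ∀ t ∈ Ico s₀ z, 0 < f t := by
    intro t ht
    by_contra! hft
    exact absurd (csInf_le hSb (show t ∈ S from ⟨ht.1, hft⟩)) (not_le.2 ht.2)
  have hlt : s₀ < z := by
    rcases hmem.1.lt_or_eq with h1 | h1
    · exact h1
    · have := hmem.2
      rw [← h1] at this
      linarith
  have hleft : ∀ᶠ t in 𝓝[<] z, t ∈ Ico s₀ z := by
    filter_upwards [Ico_mem_nhdsLT hlt] with t ht using ht
  have hge : 0 ≤ f z := by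
    have ht : Tendsto f (𝓝[<] z) (𝓝 (f z)) := (hcont.tendsto z).mono_left nhdsWithin_le_nhds
    exact ge_of_tendsto ht (hleft.mono fun t ht => (hbefore t ht).le)
  have hfz : f z = 0 := le_antisymm hmem.2 hge
  have hpos := h z hlt hbefore hfz
  have hslope : Tendsto (slope f z) (𝓝[<] z) (𝓝 (f' z)) :=
    (hasDerivAt_iff_tendsto_slope.1 (hf z)).mono_left
      (nhdsWithin_mono _ fun t (ht : t < z) => ht.ne)
  have : f' z ≤ 0 := by
    refine le_of_tendsto hslope (hleft.mono fun t ht => ?_)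
    rw [slope_def_field, hfz, sub_zero]
    exact div_nonpos_of_nonneg_of_nonpos (hbefore t ht).le (by linarith [ht.2])
  linarith

lemma exists_linear_le_of_eventually_le_deriv {f f' : ℝ → ℝ} {δ : ℝ}
    (hf : ∀ s, HasDerivAt f (f' s) s) (h : ∀ᶠ s in atTop, δ ≤ f' s) :
    ∃ s₀, ∀ s, s₀ ≤ s → f s₀ + δ * (s - s₀) ≤ f s := by
  obtain ⟨s₀, hs₀⟩ := eventually_atTop.1 h
  refine ⟨s₀, fun s hs => ?_⟩
  have hmono : MonotoneOn (fun t => f t - δ * t) (Ici s₀) := by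
    have hd : ∀ t, HasDerivAt (fun t => f t - δ * t) (f' t - δ) t := fun t =>
      ((hf t).sub ((hasDerivAt_id t).const_mul δ)).congr_deriv (by simp)
    refine monotoneOn_of_deriv_nonneg (convex_Ici s₀)
      (fun t _ => (hd t).continuousAt.continuousWithinAt)
      (fun t _ => (hd t).differentiableAt.differentiableWithinAt) fun t ht => ?_
    rw [(hd t).deriv]
    rw [interior_Ici] at ht
    linarith [hs₀ t (le_of_lt ht)]
  have := hmono (mem_Ici.2 le_rfl) (mem_Ici.2 hs) hs
  simp only at this
  linarith

lemma tendsto_atTop_of_eventually_le_deriv {f f' : ℝ → ℝ} {δ : ℝ} (hδ : 0 < δ)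
    (hf : ∀ s, HasDerivAt f (f' s) s) (h : ∀ᶠ s in atTop, δ ≤ f' s) :
    Tendsto f atTop atTop := by
  obtain ⟨s₀, hs₀⟩ := exists_linear_le_of_eventually_le_deriv hf h
  have hlin : Tendsto (fun s => f s₀ + δ * (s - s₀)) atTop atTop :=
    tendsto_atTop_add_const_left _ _
      ((tendsto_atTop_add_const_right _ (-s₀) tendsto_id).const_mul_atTop hδ)
  exact tendsto_atTop_mono' _ (eventually_atTop.2 ⟨s₀, hs₀⟩) hlin

lemma eventually_lt_of_damped {y A r : ℝ → ℝ}
    (hy : ∀ s, HasDerivAt y (r s - A s * y s) s) (hA : Tendsto A atTop atTop)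
    (hr : r =o[atTop] A) {δ : ℝ} (hδ : 0 < δ) : ∀ᶠ s in atTop, y s < δ := by
  have h1 : ∀ᶠ s in atTop, ∀ z, δ ≤ z → r s - A s * z ≤ -(δ / 2) := by
    filter_upwards [hA.eventually_ge_atTop 1, hr.bound (half_pos hδ)] with s hAs hrs z hz
    rw [Real.norm_eq_abs, Real.norm_eq_abs, abs_of_pos (by linarith : 0 < A s)] at hrs
    have := le_abs_self (r s)
    nlinarith
  obtain ⟨s₀, hs₀⟩ := eventually_atTop.1 h1
  obtain ⟨s₁, hs₁, hlt⟩ : ∃ s₁, s₀ ≤ s₁ ∧ y s₁ < δ := by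
    by_contra! hcon
    have hneg : Tendsto (fun s => -y s) atTop atTop :=
      tendsto_atTop_of_eventually_le_deriv (half_pos hδ) (fun s => (hy s).neg)
        (eventually_atTop.2 ⟨s₀, fun s hs => by linarith [hs₀ s hs _ (hcon s hs)]⟩)
    obtain ⟨s, hs, hs'⟩ :=
      ((hneg.eventually_gt_atTop 0).and (eventually_ge_atTop s₀)).exists
    linarith [hcon s hs']
  refine eventually_atTop.2 ⟨s₁, fun s hs => ?_⟩
  have := pos_of_first_zero (f := fun s => δ - y s) (s₀ := s₁)
    (fun s => (hy s).const_sub δ) (by linarith)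
    (fun s hs' _ hz => by
      have := hs₀ s (by linarith) (y s) (by linarith)
      linarith) s hs
  linarith

/-- Solutions of `y' = r - A y` tend to zero if the damping `A` tends to infinity and dominates the
forcing `r`. This is the only stability input of the asymptotic analysis. -/
lemma tendsto_zero_of_damped {y A r : ℝ → ℝ}
    (hy : ∀ s, HasDerivAt y (r s - A s * y s) s) (hA : Tendsto A atTop atTop)
    (hr : r =o[atTop] A) : Tendsto y atTop (𝓝 0) := by
  have hy' : ∀ s, HasDerivAt (fun s => -y s) ((fun s => -r s) s - A s * (fun s => -y s) s) s :=
    fun s => (hy s).neg.congr_deriv (by ring)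
  rw [Metric.tendsto_nhds]
  intro δ hδ
  filter_upwards [eventually_lt_of_damped hy hA hr hδ,
    eventually_lt_of_damped hy' hA hr.neg_left hδ] with s h1 h2
  rw [Real.dist_eq, sub_zero, abs_lt]
  constructor <;> linarith

lemma abs_rpow_sub_rpow_le {p M x y : ℝ} (hp : 1 ≤ p) (hx : 0 ≤ x) (hy : 0 ≤ y)
    (hxM : x ≤ M) (hyM : y ≤ M) : |x ^ p - y ^ p| ≤ p * M ^ (p - 1) * |x - y| := by
  have := (convex_Icc (0 : ℝ) M).norm_image_sub_le_of_norm_hasDerivWithin_le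
    (f := fun z => z ^ p) (f' := fun z => p * z ^ (p - 1)) (C := p * M ^ (p - 1))
    (fun z _ => (Real.hasDerivAt_rpow_const (Or.inr hp)).hasDerivWithinAt)
    (fun z hz => by
      rw [Real.norm_eq_abs, abs_of_nonneg (by have := Real.rpow_nonneg hz.1 (p - 1); positivity)]
      exact mul_le_mul_of_nonneg_left (Real.rpow_le_rpow hz.1 hz.2 (by linarith)) (by linarith))
    ⟨hy, hyM⟩ ⟨hx, hxM⟩
  simpa [Real.norm_eq_abs] using this

/-! ### Uniqueness of the normalized orbit -/

/-- `(V, Y)` is a positive orbit of the Liénard system `V' = (κ-a)V - kV^p + Y`, `Y' = aκV` which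
leaves the origin along the unstable direction, normalized by `e^{-κs} V(s) → 1` as `s → -∞`. No
condition is put on `Y` at `-∞`; that `e^{-κs} Y(s) → a` is proved in `IsOrbit.tendsto_snd`. -/
structure IsOrbit (a κ k p : ℝ) (V Y : ℝ → ℝ) : Prop where
  pos : ∀ s, 0 < V s
  hasDerivAt_fst : ∀ s, HasDerivAt V ((κ - a) * V s - k * V s ^ p + Y s) s
  hasDerivAt_snd : ∀ s, HasDerivAt Y (a * κ * V s) s
  tendsto_fst : Tendsto (fun s => exp (-κ * s) * V s) atBot (𝓝 1)

lemma hasDerivAt_exp_mul (c s : ℝ) : HasDerivAt (fun s => exp (c * s)) (c * exp (c * s)) s := by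
  simpa [mul_comm] using ((hasDerivAt_id s).const_mul c).exp

lemma tendsto_exp_mul_atBot {c : ℝ} (hc : 0 < c) :
    Tendsto (fun s => exp (c * s)) atBot (𝓝 0) :=
  tendsto_exp_atBot.comp (tendsto_id.const_mul_atBot hc)

lemma bounds_of_deriv_le_exp {f f' : ℝ → ℝ} {s₀ C ρ : ℝ} (hρ : 0 < ρ)
    (hf : ∀ s, HasDerivAt f (f' s) s) (h0 : ∀ s, s ≤ s₀ → 0 ≤ f' s)
    (h1 : ∀ s, s ≤ s₀ → f' s ≤ C * exp (ρ * s)) :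
    MonotoneOn f (Iic s₀) ∧ AntitoneOn (fun s => f s - C / ρ * exp (ρ * s)) (Iic s₀) := by
  constructor
  · refine monotoneOn_of_deriv_nonneg (convex_Iic s₀)
      (fun t _ => (hf t).continuousAt.continuousWithinAt)
      (fun t _ => (hf t).differentiableAt.differentiableWithinAt) fun t ht => ?_
    rw [(hf t).deriv]
    rw [interior_Iic] at ht
    exact h0 t (le_of_lt ht)
  · have hd : ∀ t, HasDerivAt (fun s => f s - C / ρ * exp (ρ * s)) (f' t - C * exp (ρ * t)) t :=
      fun t => ((hf t).sub ((hasDerivAt_exp_mul ρ t).const_mul (C / ρ))).congr_deriv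
        (by field_simp)
    refine antitoneOn_of_deriv_nonpos (convex_Iic s₀)
      (fun t _ => (hd t).continuousAt.continuousWithinAt)
      (fun t _ => (hd t).differentiableAt.differentiableWithinAt) fun t ht => ?_
    rw [(hd t).deriv]
    rw [interior_Iic] at ht
    linarith [h1 t (le_of_lt ht)]

lemma bounds_of_deriv_le_exp_of_tendsto {f f' : ℝ → ℝ} {s₀ C ρ : ℝ} (hρ : 0 < ρ)
    (hf : ∀ s, HasDerivAt f (f' s) s) (h0 : ∀ s, s ≤ s₀ → 0 ≤ f' s)
    (h1 : ∀ s, s ≤ s₀ → f' s ≤ C * exp (ρ * s)) (hlim : Tendsto f atBot (𝓝 0))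
    {s : ℝ} (hs : s ≤ s₀) : 0 ≤ f s ∧ f s ≤ C / ρ * exp (ρ * s) := by
  obtain ⟨hm, ha⟩ := bounds_of_deriv_le_exp hρ hf h0 h1
  constructor
  · exact le_of_tendsto hlim ((eventually_le_atBot s).mono fun t ht =>
      hm (mem_Iic.2 (ht.trans hs)) (mem_Iic.2 hs) ht)
  · have hl : Tendsto (fun s => f s - C / ρ * exp (ρ * s)) atBot (𝓝 0) := by
      simpa using hlim.sub ((tendsto_exp_mul_atBot hρ).const_mul (C / ρ))
    have := ge_of_tendsto hl ((eventually_le_atBot s).mono fun t ht =>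
      ha (mem_Iic.2 (ht.trans hs)) (mem_Iic.2 hs) ht)
    simp only at this
    linarith

namespace IsOrbit

variable {a κ k p : ℝ} {V Y : ℝ → ℝ}

lemma exists_le_two_mul_exp (h : IsOrbit a κ k p V Y) :
    ∃ s₀, ∀ s, s ≤ s₀ → V s ≤ 2 * exp (κ * s) := by
  obtain ⟨s₀, hs₀⟩ := eventually_atBot.1
    (h.tendsto_fst.eventually (eventually_le_nhds (by norm_num : (1 : ℝ) < 2)))
  refine ⟨s₀, fun s hs => ?_⟩
  have := mul_le_mul_of_nonneg_left (hs₀ s hs) (exp_pos (κ * s)).le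
  rw [← mul_assoc, ← exp_add] at this
  simp only [neg_mul, add_neg_cancel, exp_zero, one_mul] at this
  linarith

/-- `V - Y/a` is, up to sign, the component along the eigenvalue `-a` of the linear part. -/
lemma hasDerivAt_stable (h : IsOrbit a κ k p V Y) (ha : 0 < a) (s : ℝ) :
    HasDerivAt (fun s => exp (a * s) * (Y s / a - V s)) (k * (exp (a * s) * V s ^ p)) s := by
  refine ((hasDerivAt_exp_mul a s).mul
    (((h.hasDerivAt_snd s).div_const a).sub (h.hasDerivAt_fst s))).congr_deriv ?_
  simp only [Pi.sub_apply]
  field_simp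
  ring

/-- `V + Y/κ` is the component along the eigenvalue `κ` of the linear part. -/
lemma hasDerivAt_unstable (h : IsOrbit a κ k p V Y) (hκ : 0 < κ) (s : ℝ) :
    HasDerivAt (fun s => exp (-κ * s) * (V s + Y s / κ)) (-(k * (exp (-κ * s) * V s ^ p))) s := by
  refine ((hasDerivAt_exp_mul (-κ) s).mul
    ((h.hasDerivAt_fst s).add ((h.hasDerivAt_snd s).div_const κ))).congr_deriv ?_
  simp only [Pi.add_apply]
  field_simp
  ring

/-- The orbit is tangent to the unstable direction: its stable component is `O(e^{pκs})` at `-∞`,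
by integrating `hasDerivAt_stable` from `-∞`. -/
lemma tendsto_snd (h : IsOrbit a κ k p V Y) (ha : 0 < a) (hκ : 0 < κ) (hk : 0 < k) (hp : 1 < p) :
    Tendsto (fun s => exp (-κ * s) * Y s) atBot (𝓝 a) := by
  obtain ⟨s₀, hs₀⟩ := h.exists_le_two_mul_exp
  have hVpos := h.pos
  -- `Y` is bounded near `-∞`, so `e^{as} Y → 0`.
  obtain ⟨hm, hanti⟩ := bounds_of_deriv_le_exp (s₀ := s₀) (C := a * κ * 2) hκ h.hasDerivAt_snd
    (fun s _ => by have := hVpos s; positivity)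
    (fun s hs => by
      have := mul_le_mul_of_nonneg_left (hs₀ s hs) (by positivity : 0 ≤ a * κ)
      linarith)
  have hVexp : Tendsto (fun s => exp (a * s) * V s) atBot (𝓝 0) := by
    have := (tendsto_exp_mul_atBot (add_pos ha hκ)).mul h.tendsto_fst
    rw [zero_mul] at this
    refine this.congr fun s => ?_
    rw [← mul_assoc, ← exp_add]
    ring_nf
  have hYexp : Tendsto (fun s => exp (a * s) * Y s) atBot (𝓝 0) := by
    have hE := tendsto_exp_mul_atBot ha
    have hl := hE.mul_const (Y s₀ - a * κ * 2 / κ * exp (κ * s₀))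
    have hu := hE.mul_const (Y s₀)
    rw [zero_mul] at hl hu
    refine tendsto_of_tendsto_of_tendsto_of_le_of_le' hl hu ?_ ?_
    · filter_upwards [eventually_le_atBot s₀] with s hs
      refine mul_le_mul_of_nonneg_left ?_ (exp_pos _).le
      have := hanti (mem_Iic.2 hs) (mem_Iic.2 le_rfl) hs
      simp only at this
      have : 0 ≤ a * κ * 2 / κ * exp (κ * s) := by positivity
      linarith
    · filter_upwards [eventually_le_atBot s₀] with s hs
      exact mul_le_mul_of_nonneg_left (hm (mem_Iic.2 hs) (mem_Iic.2 le_rfl) hs) (exp_pos _).le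
  have hQ0 : Tendsto (fun s => exp (a * s) * (Y s / a - V s)) atBot (𝓝 0) := by
    have := (hYexp.div_const a).sub hVexp
    rw [zero_div, sub_zero] at this
    refine this.congr fun s => by ring
  -- Integrating from `-∞`, the stable component is `O(e^{pκs})`.
  have hbd := fun s (hs : s ≤ s₀) => bounds_of_deriv_le_exp_of_tendsto (s₀ := s₀)
    (C := k * 2 ^ p) (ρ := a + p * κ) (by positivity) (h.hasDerivAt_stable ha)
    (fun s _ => by have := rpow_pos_of_pos (hVpos s) p; positivity)
    (fun s hs => by
      have h1 := rpow_le_rpow (hVpos s).le (hs₀ s hs) (by linarith : 0 ≤ p)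
      rw [mul_rpow (by norm_num) (exp_pos _).le, ← exp_mul] at h1
      have h2 : exp ((a + p * κ) * s) = exp (a * s) * exp (κ * s * p) := by
        rw [← exp_add]; ring_nf
      rw [h2]
      calc k * (exp (a * s) * V s ^ p) ≤ k * (exp (a * s) * (2 ^ p * exp (κ * s * p))) := by
            gcongr
        _ = _ := by ring) hQ0 hs
  have hω : 0 < (p - 1) * κ := mul_pos (by linarith) hκ
  have hQ1 : Tendsto (fun s => exp (-κ * s) * (Y s / a - V s)) atBot (𝓝 0) := by
    have hu := (tendsto_exp_mul_atBot hω).const_mul (k * 2 ^ p / (a + p * κ))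
    rw [mul_zero] at hu
    have hfac : ∀ s, exp (-κ * s) * (Y s / a - V s)
        = exp (-(a + κ) * s) * (exp (a * s) * (Y s / a - V s)) := fun s => by
      rw [← mul_assoc, ← exp_add]; ring_nf
    refine tendsto_of_tendsto_of_tendsto_of_le_of_le' tendsto_const_nhds hu ?_ ?_
    · filter_upwards [eventually_le_atBot s₀] with s hs
      rw [hfac]
      exact mul_nonneg (exp_pos _).le (hbd s hs).1
    · filter_upwards [eventually_le_atBot s₀] with s hs
      rw [hfac]
      refine (mul_le_mul_of_nonneg_left (hbd s hs).2 (exp_pos _).le).trans (le_of_eq ?_)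
      rw [mul_left_comm, ← exp_add]
      ring_nf
  have := (hQ1.add h.tendsto_fst).const_mul a
  rw [zero_add, mul_one] at this
  refine this.congr fun s => ?_
  field_simp
  ring

lemma snd_pos (h : IsOrbit a κ k p V Y) (ha : 0 < a) (hκ : 0 < κ) (hk : 0 < k) (hp : 1 < p)
    (s : ℝ) : 0 < Y s := by
  have hmono : StrictMono Y := strictMono_of_deriv_pos fun s => by
    rw [(h.hasDerivAt_snd s).deriv]
    have := h.pos s
    positivity
  have h0 : Tendsto Y atBot (𝓝 0) := by
    have := (tendsto_exp_mul_atBot hκ).mul (h.tendsto_snd ha hκ hk hp)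
    rw [zero_mul] at this
    refine this.congr fun s => ?_
    rw [← mul_assoc, ← exp_add]
    simp
  exact (hmono.monotone.le_of_tendsto h0 (s - 1)).trans_lt (hmono (by linarith))

lemma fst_le (h : IsOrbit a κ k p V Y) (ha : 0 < a) (hκ : 0 < κ) (hk : 0 < k) (hp : 1 < p)
    (s : ℝ) : V s ≤ (1 + a / κ) * exp (κ * s) := by
  have hanti : Antitone (fun s => exp (-κ * s) * (V s + Y s / κ)) :=
    antitone_of_deriv_nonpos (fun s => (h.hasDerivAt_unstable hκ s).differentiableAt) fun s => by
      rw [(h.hasDerivAt_unstable hκ s).deriv]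
      have := rpow_pos_of_pos (h.pos s) p
      have : 0 ≤ k * (exp (-κ * s) * V s ^ p) := by positivity
      linarith
  have hlim : Tendsto (fun s => exp (-κ * s) * (V s + Y s / κ)) atBot (𝓝 (1 + a / κ)) :=
    (h.tendsto_fst.add ((h.tendsto_snd ha hκ hk hp).div_const κ)).congr fun s => by ring
  have h1 := hanti.ge_of_tendsto hlim s
  have hY := h.snd_pos ha hκ hk hp s
  have h2 : exp (-κ * s) * V s ≤ 1 + a / κ := by
    refine le_trans ?_ h1
    have : 0 ≤ Y s / κ := by positivity
    exact mul_le_mul_of_nonneg_left (by linarith) (exp_pos _).le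
  have h3 := mul_le_mul_of_nonneg_right h2 (exp_pos (κ * s)).le
  rwa [mul_right_comm, ← exp_add, neg_mul, neg_add_cancel, exp_zero, one_mul] at h3

theorem unique {V₁ Y₁ V₂ Y₂ : ℝ → ℝ} (h₁ : IsOrbit a κ k p V₁ Y₁) (h₂ : IsOrbit a κ k p V₂ Y₂)
    (ha : 0 < a) (hκ : 0 < κ) (hk : 0 < k) (hp : 1 < p) : V₁ = V₂ := by
  set ω := (p - 1) * κ with hωdef
  have hω : 0 < ω := mul_pos (by linarith) hκ
  set M := 1 + a / κ with hM
  have hMpos : 0 < M := by positivity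
  set c₀ := k * (p * M ^ (p - 1)) with hc₀
  have hc₀pos : 0 < c₀ := by have := rpow_pos_of_pos hMpos (p - 1); positivity
  set P : ℝ → ℝ := fun s => exp (-κ * s) * (V₁ s + Y₁ s / κ) - exp (-κ * s) * (V₂ s + Y₂ s / κ)
    with hP
  set Q : ℝ → ℝ := fun s => exp (-(a + κ) * s) *
    (exp (a * s) * (Y₁ s / a - V₁ s) - exp (a * s) * (Y₂ s / a - V₂ s)) with hQ
  set R : ℝ → ℝ := fun s => k * (exp (-κ * s) * (V₁ s ^ p - V₂ s ^ p)) with hR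
  have hPd : ∀ s, HasDerivAt P (-R s) s := fun s =>
    ((h₁.hasDerivAt_unstable hκ s).sub (h₂.hasDerivAt_unstable hκ s)).congr_deriv
      (by simp only [hR]; ring)
  have hexp : ∀ s, exp (-(a + κ) * s) * exp (a * s) = exp (-κ * s) := fun s => by
    rw [← exp_add]; ring_nf
  have hQd : ∀ s, HasDerivAt Q (-(a + κ) * Q s + R s) s := fun s =>
    ((hasDerivAt_exp_mul (-(a + κ)) s).mul
      ((h₁.hasDerivAt_stable ha s).sub (h₂.hasDerivAt_stable ha s))).congr_deriv (by
        simp only [hR, hQ, Pi.sub_apply, ← hexp]; ring)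
  have hV : ∀ s, exp (-κ * s) * (V₁ s - V₂ s) = (κ * P s - a * Q s) / (κ + a) := fun s => by
    have : Q s = exp (-κ * s) * ((Y₁ s / a - V₁ s) - (Y₂ s / a - V₂ s)) := by
      simp only [hQ, ← hexp]; ring
    rw [this]
    simp only [hP]
    field_simp
    ring
  have hRle : ∀ s, |R s| ≤ c₀ * exp (ω * s) * (|P s| + |Q s|) := fun s => by
    have h1 := abs_rpow_sub_rpow_le (p := p) hp.le (h₁.pos s).le (h₂.pos s).le
      (h₁.fst_le ha hκ hk hp s) (h₂.fst_le ha hκ hk hp s)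
    rw [mul_rpow hMpos.le (exp_pos _).le, ← exp_mul] at h1
    have h2 : exp (κ * s * (p - 1)) = exp (ω * s) := by rw [hωdef]; ring_nf
    rw [h2] at h1
    have h3 : |exp (-κ * s) * (V₁ s - V₂ s)| ≤ |P s| + |Q s| := by
      rw [hV, abs_div, abs_of_pos (by positivity : 0 < κ + a), div_le_iff₀ (by positivity)]
      have := abs_sub (κ * P s) (a * Q s)
      rw [abs_mul, abs_mul, abs_of_pos hκ, abs_of_pos ha] at this
      have h5 := abs_nonneg (P s)
      have h6 := abs_nonneg (Q s)
      have h7 := mul_nonneg ha.le h5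
      have h8 := mul_nonneg hκ.le h6
      linarith
    rw [abs_mul, abs_of_pos (exp_pos _)] at h3
    simp only [hR]
    rw [abs_mul, abs_mul, abs_of_pos hk, abs_of_pos (exp_pos _)]
    calc k * (exp (-κ * s) * |V₁ s ^ p - V₂ s ^ p|)
        ≤ k * (exp (-κ * s) * (p * (M ^ (p - 1) * exp (ω * s)) * |V₁ s - V₂ s|)) := by gcongr
      _ = c₀ * exp (ω * s) * (exp (-κ * s) * |V₁ s - V₂ s|) := by rw [hc₀]; ring
      _ ≤ _ := by gcongr
  -- `P`, `Q` are the rescaled differences of the two components, and `E' ≤ 4 c₀ e^{ωs} E`;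
  -- the integrating factor `exp (-(4c₀/ω) e^{ωs})` tends to `1` at `-∞`.
  set E : ℝ → ℝ := fun s => P s ^ 2 + Q s ^ 2 with hE
  set G : ℝ → ℝ := fun s => E s * exp (-(4 * c₀ / ω) * exp (ω * s)) with hG
  have hGd : ∀ s, HasDerivAt G ((2 * P s * (-R s) + 2 * Q s * (-(a + κ) * Q s + R s)
      - 4 * c₀ * exp (ω * s) * E s) * exp (-(4 * c₀ / ω) * exp (ω * s))) s := fun s => by
    refine ((((hPd s).pow 2).add ((hQd s).pow 2)).mul
      (((hasDerivAt_exp_mul ω s).const_mul (-(4 * c₀ / ω))).exp)).congr_deriv ?_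
    simp only [hE, Pi.add_apply, Pi.pow_apply]
    field_simp
    ring
  have hanti : Antitone G := antitone_of_deriv_nonpos (fun s => (hGd s).differentiableAt)
    fun s => by
      rw [(hGd s).deriv]
      refine mul_nonpos_of_nonpos_of_nonneg ?_ (exp_pos _).le
      have h1 := hRle s
      have h2 : 2 * P s * (-R s) + 2 * Q s * R s ≤ 2 * (|P s| + |Q s|) * |R s| := by
        have h3 : -(P s * R s) ≤ |P s| * |R s| := by
          rw [← abs_mul]; exact neg_le_abs _
        have h4 : Q s * R s ≤ |Q s| * |R s| := by
          rw [← abs_mul]; exact le_abs_self _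
        linarith
      have h3 : 2 * (|P s| + |Q s|) * |R s|
          ≤ 2 * (|P s| + |Q s|) * (c₀ * exp (ω * s) * (|P s| + |Q s|)) := by
        gcongr
      have h4 : (|P s| + |Q s|) ^ 2 ≤ 2 * E s := by
        simp only [hE]
        nlinarith [sq_abs (P s), sq_abs (Q s), sq_nonneg (|P s| - |Q s|)]
      have h5 : 0 < c₀ * exp (ω * s) := by positivity
      have h6 := mul_le_mul_of_nonneg_left h4 h5.le
      have h7 : 0 ≤ (a + κ) * Q s ^ 2 := by positivity
      linarith
  have hPlim : Tendsto P atBot (𝓝 0) := by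
    have e1 := (h₁.tendsto_fst.add ((h₁.tendsto_snd ha hκ hk hp).div_const κ))
    have e2 := (h₂.tendsto_fst.add ((h₂.tendsto_snd ha hκ hk hp).div_const κ))
    have := e1.sub e2
    rw [sub_self] at this
    refine this.congr fun s => by simp only [hP]; ring
  have hQlim : Tendsto Q atBot (𝓝 0) := by
    have e1 := (((h₁.tendsto_snd ha hκ hk hp).div_const a).sub h₁.tendsto_fst)
    have e2 := (((h₂.tendsto_snd ha hκ hk hp).div_const a).sub h₂.tendsto_fst)
    have := e1.sub e2
    rw [sub_self] at this
    refine this.congr fun s => by simp only [hQ, ← hexp]; ring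
  have hGlim : Tendsto G atBot (𝓝 0) := by
    have e1 := (hPlim.pow 2).add (hQlim.pow 2)
    have e2 : Tendsto (fun s => exp (-(4 * c₀ / ω) * exp (ω * s))) atBot (𝓝 1) := by
      have := ((tendsto_exp_mul_atBot hω).const_mul (-(4 * c₀ / ω))).rexp
      simpa using this
    have e3 := e1.mul e2
    rw [mul_one, zero_pow two_ne_zero, add_zero] at e3
    exact e3
  funext s
  have h1 : G s ≤ 0 := hanti.ge_of_tendsto hGlim s
  have h2 : E s ≤ 0 := by
    by_contra! hcon
    exact absurd h1 (not_le.2 (mul_pos hcon (exp_pos _)))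
  simp only [hE] at h2
  have hP0 : P s = 0 := pow_eq_zero_iff two_ne_zero |>.1
    (le_antisymm (by linarith [sq_nonneg (Q s)]) (sq_nonneg _))
  have hQ0 : Q s = 0 := pow_eq_zero_iff two_ne_zero |>.1
    (le_antisymm (by linarith [sq_nonneg (P s)]) (sq_nonneg _))
  have := hV s
  rw [hP0, hQ0] at this
  simp only [mul_zero, sub_self, zero_div, mul_eq_zero, (exp_pos _).ne', false_or] at this
  linarith

end IsOrbit

/-! ### Existence of the normalized orbit -/

open scoped BoundedContinuousFunction NNReal

/-- A Volterra equation with bounded Lipschitz nonlinearity is solvable on `[0,∞)`. The unknown is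
written `u(x) = e^{M|x|} φ(|x|)` with `φ` bounded and continuous on `ℝ`; for `M` large the equation
is a fixed point problem for a contraction in `φ`. The integral is over `t = y/x ∈ [0,1]`, so that
kernels depending on `y/x` cause no trouble at `x = 0`. -/
theorem exists_volterra_solution {F k : ℝ → ℝ} {C L N : ℝ} (hk : Continuous k)
    (hkC : ∀ t ∈ Icc (0 : ℝ) 1, |k t| ≤ C) (hF : ∀ x y, |F x - F y| ≤ L * |x - y|)
    (hFN : ∀ x, |F x| ≤ N) :
    ∃ u : ℝ → ℝ, Continuous u ∧
      ∀ x, 0 ≤ x → u x = 1 - x * ∫ t in (0 : ℝ)..1, k t * F (u (x * t)) := by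
  have hC : 0 ≤ C := (abs_nonneg _).trans (hkC 0 (by simp))
  have hN : 0 ≤ N := (abs_nonneg _).trans (hFN 0)
  have hL : 0 ≤ L := by
    have := (abs_nonneg _).trans (hF 1 0)
    simpa using this
  have hFc : Continuous F := by
    refine LipschitzWith.continuous (K := L.toNNReal) (LipschitzWith.of_dist_le_mul fun x y => ?_)
    rw [Real.dist_eq, Real.dist_eq, Real.coe_toNNReal _ hL]
    exact hF x y
  -- The contraction constant will be `C L / M ≤ 1/2`.
  set M : ℝ := 2 * (C * L) + 1 with hM
  have hM1 : 1 ≤ M := by have := mul_nonneg hC hL; linarith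
  have hMpos : 0 < M := by linarith
  set S : (ℝ →ᵇ ℝ) → ℝ → ℝ → ℝ := fun φ x t => k t * F (exp (M * (|x| * t)) * φ (|x| * t)) with hS
  have hSc : ∀ φ, Continuous (Function.uncurry (S φ)) := fun φ => by
    simp only [hS, Function.uncurry_def]
    have := φ.continuous
    fun_prop
  have hSc' : ∀ φ x, Continuous (S φ x) := fun φ x =>
    (hSc φ).comp (by fun_prop : Continuous fun t : ℝ => (x, t))
  have hSb : ∀ φ x, |∫ t in (0 : ℝ)..1, S φ x t| ≤ C * N := fun φ x => by
    have := intervalIntegral.norm_integral_le_of_norm_le_const (a := (0 : ℝ)) (b := 1)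
      (f := S φ x) (C := C * N) fun t ht => by
        rw [uIoc_of_le zero_le_one] at ht
        simp only [hS, norm_mul, Real.norm_eq_abs]
        exact mul_le_mul (hkC t ⟨ht.1.le, ht.2⟩) (hFN _) (abs_nonneg _) hC
    simpa using this
  set T₀ : (ℝ →ᵇ ℝ) → ℝ → ℝ := fun φ x =>
    exp (-(M * |x|)) * (1 - |x| * ∫ t in (0 : ℝ)..1, S φ x t) with hT₀
  have hT₀c : ∀ φ, Continuous (T₀ φ) := fun φ => by
    have := intervalIntegral.continuous_parametric_intervalIntegral_of_continuous' (hSc φ) 0 1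
      (μ := MeasureTheory.volume)
    simp only [hT₀]
    fun_prop
  have hexp : ∀ x : ℝ, exp (-(M * |x|)) * |x| ≤ 1 := fun x => by
    rw [exp_neg, inv_mul_le_iff₀ (exp_pos _), mul_one]
    have := add_one_le_exp (M * |x|)
    nlinarith [abs_nonneg x]
  have hT₀b : ∀ φ x, ‖T₀ φ x‖ ≤ 1 + C * N := fun φ x => by
    simp only [hT₀, norm_mul, Real.norm_eq_abs, abs_of_pos (exp_pos _)]
    have h1 : |1 - |x| * ∫ t in (0 : ℝ)..1, S φ x t| ≤ 1 + |x| * (C * N) := by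
      refine (abs_sub _ _).trans ?_
      rw [abs_one, abs_mul, abs_abs]
      gcongr
      exact hSb φ x
    have h2 : exp (-(M * |x|)) ≤ 1 := exp_le_one_iff.2 (by have := abs_nonneg x; nlinarith)
    have h3 := mul_le_mul_of_nonneg_right (hexp x) (mul_nonneg hC hN)
    calc _ ≤ exp (-(M * |x|)) * (1 + |x| * (C * N)) := by gcongr
      _ ≤ _ := by linarith
  set T : (ℝ →ᵇ ℝ) → (ℝ →ᵇ ℝ) := fun φ =>
    BoundedContinuousFunction.ofNormedAddCommGroup (T₀ φ) (hT₀c φ) _ (hT₀b φ) with hT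
  have hcontr : ContractingWith (1 / 2 : ℝ≥0) T := by
    refine ⟨by norm_num, LipschitzWith.of_dist_le_mul fun φ ψ => ?_⟩
    rw [BoundedContinuousFunction.dist_le (by positivity)]
    intro x
    have hint : ∫ t in (0 : ℝ)..1, |x| * exp (M * (|x| * t)) = (exp (M * |x|) - 1) / M := by
      have hd : ∀ t : ℝ, HasDerivAt (fun t => exp (M * (|x| * t)) / M)
          (|x| * exp (M * (|x| * t))) t := fun t =>
        (((((hasDerivAt_id t).const_mul |x|).const_mul M).exp).div_const M).congr_deriv (by
          field_simp
          simp)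
      rw [intervalIntegral.integral_eq_sub_of_hasDerivAt (fun t _ => hd t)
        (Continuous.intervalIntegrable (by fun_prop) _ _)]
      simp [sub_div]
    have h1 : |x| * |(∫ t in (0 : ℝ)..1, S φ x t) - ∫ t in (0 : ℝ)..1, S ψ x t|
        ≤ C * L * dist φ ψ * ((exp (M * |x|) - 1) / M) := by
      rw [← intervalIntegral.integral_sub ((hSc' φ x).intervalIntegrable _ _)
        ((hSc' ψ x).intervalIntegrable _ _), ← hint, ← intervalIntegral.integral_const_mul]
      have := intervalIntegral.norm_integral_le_of_norm_le (a := (0 : ℝ)) (b := 1)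
        (μ := MeasureTheory.volume)
        (f := fun t => |x| * (S φ x t - S ψ x t))
        (g := fun t => C * L * dist φ ψ * (|x| * exp (M * (|x| * t)))) zero_le_one
        (Filter.Eventually.of_forall fun t ht => by
          simp only [hS, norm_mul, Real.norm_eq_abs, abs_abs, ← mul_sub]
          have e1 := hF (exp (M * (|x| * t)) * φ (|x| * t)) (exp (M * (|x| * t)) * ψ (|x| * t))
          rw [← mul_sub, abs_mul, abs_of_pos (exp_pos _)] at e1
          have e2 : |φ (|x| * t) - ψ (|x| * t)| ≤ dist φ ψ := by
            rw [← Real.dist_eq]; exact BoundedContinuousFunction.dist_coe_le_dist _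
          have e3 := hkC t ⟨ht.1.le, ht.2⟩
          calc |x| * (|k t| * |F (exp (M * (|x| * t)) * φ (|x| * t))
                - F (exp (M * (|x| * t)) * ψ (|x| * t))|)
              ≤ |x| * (C * (L * (exp (M * (|x| * t)) * dist φ ψ))) := by
                gcongr
                refine e1.trans ?_
                gcongr
            _ = _ := by ring)
        (Continuous.intervalIntegrable (by fun_prop) _ _)
      rw [intervalIntegral.integral_const_mul, norm_mul, Real.norm_eq_abs, Real.norm_eq_abs,
        abs_abs] at this
      exact this
    simp only [hT, BoundedContinuousFunction.coe_ofNormedAddCommGroup, hT₀, Real.dist_eq]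
    rw [← mul_sub, abs_mul, abs_of_pos (exp_pos _), sub_sub_sub_cancel_left, ← mul_sub, abs_mul,
      abs_abs, abs_sub_comm]
    have hd : 0 ≤ dist φ ψ := dist_nonneg
    have hCL : C * L / M ≤ 1 / 2 := by
      rw [div_le_iff₀ hMpos]; linarith
    calc _ ≤ exp (-(M * |x|)) * (C * L * dist φ ψ * ((exp (M * |x|) - 1) / M)) := by gcongr
      _ ≤ exp (-(M * |x|)) * (C * L * dist φ ψ * (exp (M * |x|) / M)) := by
          gcongr; linarith
      _ = C * L / M * dist φ ψ := by
          rw [exp_neg]; field_simp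
      _ ≤ 1 / 2 * dist φ ψ := by gcongr
      _ = _ := by simp
  set φ := hcontr.fixedPoint with hφ
  have hfix : T φ = φ := hcontr.fixedPoint_isFixedPt
  refine ⟨fun x => exp (M * |x|) * φ |x|, ?_, fun x hx => ?_⟩
  · have := φ.continuous
    fun_prop
  · have h1 : φ x = T₀ φ x := by
      conv_lhs => rw [← hfix]
      rfl
    simp only
    rw [abs_of_nonneg hx, h1]
    simp only [hT₀]
    rw [abs_of_nonneg hx, ← mul_assoc, ← exp_add, add_neg_cancel, exp_zero, one_mul]
    congr 2
    refine intervalIntegral.integral_congr fun t ht => ?_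
    rw [uIcc_of_le zero_le_one] at ht
    simp only [hS]
    rw [abs_of_nonneg hx, abs_of_nonneg (mul_nonneg hx ht.1)]

/-- The power `x^p` with `x` first clamped to `[0,1]`: bounded and globally Lipschitz. -/
def truncRpow (p x : ℝ) : ℝ := max 0 (min x 1) ^ p

lemma truncRpow_eq {p x : ℝ} (h0 : 0 ≤ x) (h1 : x ≤ 1) : truncRpow p x = x ^ p := by
  rw [truncRpow, min_eq_left h1, max_eq_right h0]

lemma truncRpow_nonneg (p x : ℝ) : 0 ≤ truncRpow p x := rpow_nonneg (le_max_left _ _) _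

lemma truncRpow_le_one {p : ℝ} (hp : 1 < p) (x : ℝ) : truncRpow p x ≤ 1 :=
  rpow_le_one (le_max_left _ _) (max_le zero_le_one (min_le_right _ _)) (by linarith)

lemma abs_truncRpow_sub_le {p : ℝ} (hp : 1 < p) (x y : ℝ) :
    |truncRpow p x - truncRpow p y| ≤ p * |x - y| := by
  have h1 := abs_rpow_sub_rpow_le (p := p) (M := 1) hp.le (le_max_left 0 (min x 1))
    (le_max_left 0 (min y 1)) (max_le zero_le_one (min_le_right _ _))
    (max_le zero_le_one (min_le_right _ _))
  rw [one_rpow, mul_one] at h1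
  refine h1.trans (mul_le_mul_of_nonneg_left ?_ (by linarith))
  exact (abs_max_sub_max_le_max 0 (min x 1) 0 (min y 1)).trans
    (by simpa using (abs_min_sub_min_le_max x 1 y 1))

lemma continuous_truncRpow {p : ℝ} (hp : 1 < p) : Continuous (truncRpow p) :=
  (continuous_const.max (continuous_id.min continuous_const)).rpow_const
    fun _ => Or.inr (by linarith)

/-- The orbit of the system in which `V^p = (e^{κs} v)^p` is replaced by `e^{pκs}` times the truncated
power of `v`. With `x = e^{ωs}`, `ω = (p-1)κ`, variation of constants in the eigendirections turns
the system into `v(s) = u(x)`,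
`u(x) = 1 - c x ∫₀¹ (κ + a t^ν) F(u(xt)) dt`, `ν = (κ+a)/ω`, `c = k/((κ+a)ω)`. -/
theorem exists_truncated_orbit {a κ k p : ℝ} (ha : 0 < a) (hκ : 0 < κ) (hk : 0 < k)
    (hp : 1 < p) :
    ∃ v Y : ℝ → ℝ, (∀ s, v s ≤ 1) ∧ Tendsto v atBot (𝓝 1) ∧ Tendsto Y atBot (𝓝 0) ∧
      (∀ s, HasDerivAt (fun s => exp (κ * s) * v s) ((κ - a) * (exp (κ * s) * v s)
        - k * (exp (κ * s) ^ p * truncRpow p (v s)) + Y s) s) ∧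
      ∀ s, HasDerivAt Y (a * κ * (exp (κ * s) * v s)) s := by
  set ω := (p - 1) * κ with hωdef
  have hω : 0 < ω := mul_pos (by linarith) hκ
  set ν := (κ + a) / ω with hνdef
  have hν : 0 < ν := by positivity
  have hνω : ω * ν = κ + a := by rw [hνdef]; field_simp
  set c := k / ((κ + a) * ω) with hc
  have hcpos : 0 < c := by positivity
  have hF := continuous_truncRpow hp
  have hpow : Continuous fun t : ℝ => t ^ ν := continuous_id.rpow_const fun _ => Or.inr hν.le
  obtain ⟨u, hu, hueq⟩ := exists_volterra_solution (F := truncRpow p)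
    (k := fun t => c * (κ + a * t ^ ν)) (C := c * (κ + a)) (L := p) (N := 1) (by fun_prop)
    (fun t ht => by
      have h1 := rpow_nonneg ht.1 ν
      have h2 := rpow_le_one ht.1 ht.2 hν.le
      rw [abs_of_nonneg (by positivity)]
      gcongr
      nlinarith)
    (abs_truncRpow_sub_le hp)
    (fun x => by rw [abs_of_nonneg (truncRpow_nonneg p x)]; exact truncRpow_le_one hp x)
  set I : ℝ → ℝ := fun x => ∫ y in (0 : ℝ)..x, truncRpow p (u y) with hI
  set J : ℝ → ℝ := fun x => ∫ y in (0 : ℝ)..x, y ^ ν * truncRpow p (u y) with hJ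
  have hId : ∀ x, HasDerivAt I (truncRpow p (u x)) x := fun x =>
    ((by fun_prop : Continuous fun y => truncRpow p (u y)).integral_hasStrictDerivAt 0 x).hasDerivAt
  have hJd : ∀ x, HasDerivAt J (x ^ ν * truncRpow p (u x)) x := fun x =>
    ((by fun_prop : Continuous fun y => y ^ ν * truncRpow p (u y)).integral_hasStrictDerivAt
      0 x).hasDerivAt
  have hu' : ∀ x, 0 < x → u x = 1 - c * (κ * I x + a * (x ^ (-ν) * J x)) := by
    intro x hx
    rw [hueq x hx.le]
    have e1 : x * ∫ t in (0 : ℝ)..1, truncRpow p (u (x * t)) = I x := by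
      have := intervalIntegral.mul_integral_comp_mul_left (a := (0 : ℝ)) (b := 1)
        (f := fun y => truncRpow p (u y)) (c := x)
      simpa [hI] using this
    have e2 : x * ∫ t in (0 : ℝ)..1, t ^ ν * truncRpow p (u (x * t)) = x ^ (-ν) * J x := by
      have := intervalIntegral.mul_integral_comp_mul_left (a := (0 : ℝ)) (b := 1)
        (f := fun y => y ^ ν * truncRpow p (u y)) (c := x)
      rw [mul_zero, mul_one] at this
      simp only [hJ]
      rw [← this, mul_left_comm]
      congr 1
      rw [← intervalIntegral.integral_const_mul]
      refine intervalIntegral.integral_congr fun t ht => ?_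
      rw [uIcc_of_le zero_le_one] at ht
      rw [mul_rpow hx.le ht.1, ← mul_assoc, ← mul_assoc, ← rpow_add hx]
      simp
    have e3 : ∀ t, c * (κ + a * t ^ ν) * truncRpow p (u (x * t))
        = c * κ * truncRpow p (u (x * t)) + c * a * (t ^ ν * truncRpow p (u (x * t))) :=
      fun t => by ring
    simp only [e3]
    rw [intervalIntegral.integral_add (Continuous.intervalIntegrable (by fun_prop) _ _)
      (Continuous.intervalIntegrable (by fun_prop) _ _), intervalIntegral.integral_const_mul,
      intervalIntegral.integral_const_mul, ← e1, ← e2]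
    ring
  have hu0 : u 0 = 1 := by simpa using hueq 0 le_rfl
  have hInn : ∀ x, 0 ≤ x → 0 ≤ I x := fun x hx =>
    intervalIntegral.integral_nonneg hx fun y _ => truncRpow_nonneg _ _
  have hJnn : ∀ x, 0 ≤ x → 0 ≤ J x := fun x hx =>
    intervalIntegral.integral_nonneg hx fun y hy =>
      mul_nonneg (rpow_nonneg hy.1 _) (truncRpow_nonneg _ _)
  set X : ℝ → ℝ := fun s => exp (ω * s) with hX
  have hXpos : ∀ s, 0 < X s := fun s => exp_pos _
  have hX0 : Tendsto X atBot (𝓝 0) := tendsto_exp_mul_atBot hω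
  have hXν : ∀ s, X s ^ ν = exp ((κ + a) * s) := fun s => by
    simp only [hX]; rw [← exp_mul, mul_right_comm, hνω]
  have hXν' : ∀ s, X s ^ (-ν) = exp (-(κ + a) * s) := fun s => by
    rw [rpow_neg (hXpos s).le, hXν, ← exp_neg]; ring_nf
  have hXp : ∀ s, exp (κ * s) * X s = exp (κ * s) ^ p := fun s => by
    simp only [hX]; rw [← exp_mul, ← exp_add, hωdef]; ring_nf
  -- `P` and `Q` are the components `V + Y/κ` and `V - Y/a` of the orbit to be constructed.
  set P : ℝ → ℝ := fun s => exp (κ * s) * (1 + a / κ - k / ω * I (X s)) with hP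
  set Q : ℝ → ℝ := fun s => -(k / ω) * (exp (-a * s) * J (X s)) with hQ
  set G : ℝ → ℝ := fun s => exp (κ * s) ^ p * truncRpow p (u (X s)) with hG
  have hXd : ∀ s, HasDerivAt X (ω * X s) s := hasDerivAt_exp_mul ω
  have hPd : ∀ s, HasDerivAt P (κ * P s - k * G s) s := fun s => by
    refine ((hasDerivAt_exp_mul κ s).mul
      ((((hId (X s)).comp s (hXd s)).const_mul (k / ω)).const_sub (1 + a / κ))).congr_deriv ?_
    simp only [hP, hG, ← hXp, Function.comp_apply]
    field_simp
    ring
  have hQd : ∀ s, HasDerivAt Q (-a * Q s - k * G s) s := fun s => by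
    refine (((hasDerivAt_exp_mul (-a) s).mul ((hJd (X s)).comp s (hXd s))).const_mul
      (-(k / ω))).congr_deriv ?_
    have : exp (-a * s) * X s ^ ν = exp (κ * s) := by
      rw [hXν, ← exp_add]; ring_nf
    simp only [hQ, hG, ← hXp, Function.comp_apply, ← this]
    field_simp
    ring
  have hVPQ : ∀ s, exp (κ * s) * u (X s) = (κ * P s + a * Q s) / (κ + a) := fun s => by
    have : exp (-a * s) = exp (κ * s) * exp (-(κ + a) * s) := by rw [← exp_add]; ring_nf
    simp only [hP, hQ]
    rw [hu' _ (hXpos s), hXν', this, hc]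
    field_simp
    ring
  refine ⟨fun s => u (X s), fun s => κ * (P s - exp (κ * s) * u (X s)), fun s => ?_, ?_, ?_,
    fun s => ?_, fun s => ?_⟩
  · simp only
    rw [hu' _ (hXpos s)]
    have h1 := hInn _ (hXpos s).le
    have h2 := hJnn _ (hXpos s).le
    have h3 := rpow_pos_of_pos (hXpos s) (-ν)
    have : 0 ≤ c * (κ * I (X s) + a * (X s ^ (-ν) * J (X s))) := by positivity
    linarith
  · have := (hu.tendsto 0).comp hX0
    rwa [hu0] at this
  · have h1 : Tendsto (fun s => u (X s)) atBot (𝓝 1) := by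
      have := (hu.tendsto 0).comp hX0
      rwa [hu0] at this
    have hI0 : I 0 = 0 := by simp [hI]
    have h2 : Tendsto (fun s => I (X s)) atBot (𝓝 0) := by
      have := ((hId 0).continuousAt.tendsto).comp hX0
      rwa [hI0] at this
    have h3 := tendsto_exp_mul_atBot hκ
    have h4 := ((h3.mul ((h2.const_mul (k / ω)).const_sub (1 + a / κ))).sub
      (h3.mul h1)).const_mul κ
    simpa using h4
  · have h1 : (fun s => exp (κ * s) * u (X s)) = fun s => (κ * P s + a * Q s) / (κ + a) :=
      funext hVPQ
    rw [h1]
    refine ((((hPd s).const_mul κ).add ((hQd s).const_mul a)).div_const (κ + a)).congr_deriv ?_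
    simp only [hVPQ, hG]
    field_simp
    ring
  · have h1 : (fun s => κ * (P s - exp (κ * s) * u (X s)))
        = fun s => κ * (P s - (κ * P s + a * Q s) / (κ + a)) := funext fun s => by rw [hVPQ]
    rw [h1, hVPQ]
    refine (((hPd s).sub ((((hPd s).const_mul κ).add ((hQd s).const_mul a)).div_const
      (κ + a))).const_mul κ).congr_deriv ?_
    field_simp
    ring

theorem exists_orbit {a κ k p : ℝ} (ha : 0 < a) (hκ : 0 < κ) (hk : 0 < k) (hp : 1 < p) :
    ∃ V Y : ℝ → ℝ, IsOrbit a κ k p V Y := by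
  obtain ⟨v, Y, hv1, hvlim, hYlim, hVd, hYd⟩ := exists_truncated_orbit ha hκ hk hp
  obtain ⟨s₀, hs₀⟩ := eventually_atBot.1 (hvlim.eventually (lt_mem_nhds zero_lt_one))
  -- At a first zero of `V` the derivative is `Y`, which is positive since `Y' = aκV > 0` up to
  -- that point and `Y → 0` at `-∞`.
  have hV : ∀ s, s₀ ≤ s → 0 < exp (κ * s) * v s := by
    refine pos_of_first_zero hVd (mul_pos (exp_pos _) (hs₀ s₀ le_rfl)) fun s hs hbefore hz => ?_
    have hv0 : v s = 0 := by simpa [(exp_pos _).ne'] using hz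
    have hmono : StrictMonoOn Y (Iic s) :=
      strictMonoOn_of_deriv_pos (convex_Iic s) (fun t _ => (hYd t).continuousAt.continuousWithinAt)
        fun t ht => by
          rw [interior_Iic] at ht
          rw [(hYd t).deriv]
          rcases le_total t s₀ with h | h
          · have := mul_pos (exp_pos (κ * t)) (hs₀ t h)
            positivity
          · have := hbefore t ⟨h, ht⟩
            positivity
    have h1 : 0 ≤ Y (s - 1) := le_of_tendsto hYlim ((eventually_le_atBot (s - 1)).mono fun t ht =>
      hmono.monotoneOn (mem_Iic.2 (by linarith)) (mem_Iic.2 (by linarith)) ht)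
    have h2 : Y (s - 1) < Y s :=
      hmono (mem_Iic.2 (by linarith)) (mem_Iic.2 le_rfl) (by linarith)
    rw [hv0, truncRpow_eq le_rfl zero_le_one, zero_rpow (by linarith)]
    simp only [mul_zero, sub_self, zero_add]
    linarith
  have hvpos : ∀ s, 0 < v s := fun s => by
    rcases le_total s s₀ with h | h
    · exact hs₀ s h
    · exact (mul_pos_iff_of_pos_left (exp_pos _)).1 (hV s h)
  refine ⟨fun s => exp (κ * s) * v s, Y, fun s => mul_pos (exp_pos _) (hvpos s), fun s => ?_, hYd,
    hvlim.congr fun s => ?_⟩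
  · have := hVd s
    rwa [truncRpow_eq (hvpos s).le (hv1 s), ← mul_rpow (exp_pos _).le (hvpos s).le] at this
  · rw [← mul_assoc, ← exp_add]
    simp

/-! ### Expansion of the orbit at infinity -/

lemma isLittleO_const_mul_of_tendsto_div {r W : ℝ → ℝ} {h : ℝ} (hh : 0 < h)
    (hW : Tendsto W atTop atTop) (hr : Tendsto (fun s => r s / W s) atTop (𝓝 0)) :
    r =o[atTop] fun s => h * W s := by
  refine IsLittleO.const_mul_right hh.ne' ?_
  refine (isLittleO_iff_tendsto' ?_).2 hr
  filter_upwards [hW.eventually_gt_atTop 0] with s hs h0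
  exact absurd h0 hs.ne'

lemma isLittleO_of_tendsto_of_atTop {r A : ℝ → ℝ} {l : ℝ} (hr : Tendsto r atTop (𝓝 l))
    (hA : Tendsto A atTop atTop) : r =o[atTop] A :=
  (hr.isBigO_one ℝ).trans_isLittleO
    ((isLittleO_const_left).2 (Or.inr (tendsto_norm_atTop_atTop.comp hA)))

section Riccati

variable {W e : ℝ → ℝ} {q c b h : ℝ}

lemma riccati_tendsto_zero (hh : 0 < h)
    (he : ∀ s, HasDerivAt e (c + b * e s - e s ^ 2 - h * W s * e s) s) (hpos : ∀ s, 0 < e s)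
    (hWtop : Tendsto W atTop atTop) : Tendsto e atTop (𝓝 0) := by
  have hA : Tendsto (fun s => h * W s - b + e s) atTop atTop :=
    tendsto_atTop_mono (fun s => by linarith [hpos s])
      (tendsto_atTop_add_const_right _ (-b) (hWtop.const_mul_atTop hh))
  exact tendsto_zero_of_damped (r := fun _ => c) (fun s => (he s).congr_deriv (by ring)) hA
    (isLittleO_of_tendsto_of_atTop tendsto_const_nhds hA)

/-- With `c/h = θ₀` the conclusions say `W e = θ₀ + θ₁/W + (θ₂ + o(1))/W²`. Each coefficient is
obtained by applying `tendsto_zero_of_damped` to the previous remainder multiplied by `W`. -/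
theorem riccati_expansion (hh : 0 < h)
    (hW : ∀ s, HasDerivAt W (q * (W s * e s)) s)
    (he : ∀ s, HasDerivAt e (c + b * e s - e s ^ 2 - h * W s * e s) s) (hpos : ∀ s, 0 < e s)
    (hWtop : Tendsto W atTop atTop) :
    Tendsto (fun s => W s * (W s * e s - c / h)) atTop (𝓝 (b * (c / h) / h)) ∧
    Tendsto (fun s => W s * (W s * (W s * e s - c / h) - b * (c / h) / h)) atTop
      (𝓝 ((b * (b * (c / h) / h) + (q - 1) * (c / h) ^ 2) / h)) := by
  have he0 := riccati_tendsto_zero hh he hpos hWtop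
  have hWinv : Tendsto (fun s => (W s)⁻¹) atTop (𝓝 0) := tendsto_inv_atTop_zero.comp hWtop
  have hhW : Tendsto (fun s => h * W s) atTop atTop := hWtop.const_mul_atTop hh
  have hWpos : ∀ᶠ s in atTop, 0 < W s := hWtop.eventually_gt_atTop 0
  set θ : ℝ → ℝ := fun s => W s * e s with hθ
  set θ₀ := c / h with hθ₀
  have hc : c = h * θ₀ := by rw [hθ₀]; field_simp
  set θ₁ := b * θ₀ / h with hθ₁
  have hθ₁' : b * θ₀ = h * θ₁ := by rw [hθ₁]; field_simp
  set θ₂ := (b * θ₁ + (q - 1) * θ₀ ^ 2) / h with hθ₂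
  have hθ₂' : b * θ₁ + (q - 1) * θ₀ ^ 2 = h * θ₂ := by rw [hθ₂]; field_simp
  have hθd : ∀ s, HasDerivAt θ
      (-h * (W s * (θ s - θ₀)) + b * θ s + (q - 1) * (θ s * e s)) s := fun s =>
    ((hW s).mul (he s)).congr_deriv (by rw [hc]; simp only [hθ]; ring)
  have hθlim : Tendsto (fun s => θ s - θ₀) atTop (𝓝 0) := by
    have hA : Tendsto (fun s => h * W s + (-b - (q - 1) * e s)) atTop atTop :=
      hhW.atTop_add ((he0.const_mul (q - 1)).const_sub (-b))
    refine tendsto_zero_of_damped (r := fun s => (b + (q - 1) * e s) * θ₀)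
      (fun s => ((hθd s).sub_const θ₀).congr_deriv (by ring)) hA
      (isLittleO_of_tendsto_of_atTop (((he0.const_mul (q - 1)).const_add b).mul_const θ₀) hA)
  have hθlim' : Tendsto θ atTop (𝓝 θ₀) := by simpa using hθlim.add_const θ₀
  set x₁ : ℝ → ℝ := fun s => W s * (θ s - θ₀) with hx₁
  have hx₁d : ∀ s, HasDerivAt x₁ (q * θ s * (θ s - θ₀)
      + W s * (-h * x₁ s + b * θ s + (q - 1) * (θ s * e s))) s := fun s =>
    ((hW s).mul ((hθd s).sub_const θ₀)).congr_deriv (by simp only [hx₁, hθ])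
  have hx₁lim : Tendsto (fun s => x₁ s - θ₁) atTop (𝓝 0) := by
    refine tendsto_zero_of_damped (A := fun s => h * W s)
      (r := fun s => q * θ s * (θ s - θ₀) + W s * (b * (θ s - θ₀) + (q - 1) * (θ s * e s)))
      (fun s => ((hx₁d s).sub_const θ₁).congr_deriv ?_) hhW
      (isLittleO_const_mul_of_tendsto_div hh hWtop ?_)
    · linear_combination W s * hθ₁'
    · have h1 := ((hθlim'.const_mul q).mul hθlim).mul hWinv
      have h2 := (hθlim.const_mul b).add ((hθlim'.mul he0).const_mul (q - 1))
      have h3 := h1.add h2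
      simp only [mul_zero, add_zero] at h3
      refine h3.congr' ?_
      filter_upwards [hWpos] with s hs
      field_simp
  have hx₁lim' : Tendsto x₁ atTop (𝓝 θ₁) := by simpa using hx₁lim.add_const θ₁
  refine ⟨hx₁lim', ?_⟩
  have hx₂lim : Tendsto (fun s => W s * (x₁ s - θ₁) - θ₂) atTop (𝓝 0) := by
    refine tendsto_zero_of_damped (A := fun s => h * W s)
      (r := fun s => q * θ s * (x₁ s - θ₁) + q * θ s * x₁ s
        + W s * (b * (x₁ s - θ₁) + (q - 1) * (θ s ^ 2 - θ₀ ^ 2)))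
      (fun s => (((hW s).mul ((hx₁d s).sub_const θ₁)).sub_const θ₂).congr_deriv ?_) hhW
      (isLittleO_const_mul_of_tendsto_div hh hWtop ?_)
    · have h1 : W s * (θ s - θ₀) = x₁ s := rfl
      have h2 : W s * e s = θ s := rfl
      rw [h2]
      linear_combination W s * hθ₂' + W s ^ 2 * hθ₁' + (q * θ s + b * W s) * h1
        + (q - 1) * W s * θ s * h2
    · have h1 := (((hθlim'.const_mul q).mul hx₁lim).add ((hθlim'.const_mul q).mul hx₁lim')).mul
        hWinv
      have h2 := (hx₁lim.const_mul b).add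
        (((hθlim'.pow 2).sub_const (θ₀ ^ 2)).const_mul (q - 1))
      have h3 := h1.add h2
      simp only [mul_zero, add_zero, sub_self] at h3
      refine h3.congr' ?_
      filter_upwards [hWpos] with s hs
      field_simp
  simpa using hx₂lim.add_const θ₂

end Riccati

lemma abs_sub_le_of_abs_deriv_le {f f' g g' : ℝ → ℝ} {s₀ : ℝ}
    (hf : ∀ s, s₀ ≤ s → HasDerivAt f (f' s) s) (hg : ∀ s, s₀ ≤ s → HasDerivAt g (g' s) s)
    (h : ∀ s, s₀ ≤ s → |f' s| ≤ g' s) {s : ℝ} (hs : s₀ ≤ s) : |f s - f s₀| ≤ g s - g s₀ := by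
  have key : ∀ {φ φ' : ℝ → ℝ}, (∀ s, s₀ ≤ s → HasDerivAt φ (φ' s) s) →
      (∀ s, s₀ ≤ s → 0 ≤ φ' s) → φ s₀ ≤ φ s := fun {φ φ'} hφ h0 => by
    refine monotoneOn_of_deriv_nonneg (convex_Ici s₀)
      (fun t ht => (hφ t ht).continuousAt.continuousWithinAt)
      (fun t ht => (hφ t (interior_subset ht)).differentiableAt.differentiableWithinAt)
      (fun t ht => ?_) (mem_Ici.2 le_rfl) (mem_Ici.2 hs) hs
    rw [(hφ t (interior_subset ht)).deriv]
    exact h0 t (interior_subset ht)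
  have h1 := key (fun s hs => (hg s hs).sub (hf s hs)) fun s hs => by
    linarith [le_abs_self (f' s), h s hs]
  have h2 := key (fun s hs => (hg s hs).add (hf s hs)) fun s hs => by
    linarith [neg_abs_le (f' s), h s hs]
  simp only [Pi.sub_apply, Pi.add_apply] at h1 h2
  rw [abs_le]
  constructor <;> linarith

lemma tendsto_log_div_sqrt : Tendsto (fun s => log s / √s) atTop (𝓝 0) := by
  have := (isLittleO_log_rpow_atTop (by norm_num : (0 : ℝ) < 1 / 2)).tendsto_div_nhds_zero
  refine this.congr fun s => by rw [sqrt_eq_rpow]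

/-- Integration of `W' = D + DB/W + (DC + o(1))/W²`. The constant `K` exists because the derivative
of `W - D s - B log s` is `O(s^{-3/2})`; the next term is found by l'Hôpital's rule. -/
theorem exists_expansion_of_deriv {W W' : ℝ → ℝ} {D B C : ℝ} (hD : 0 < D)
    (hW : ∀ s, HasDerivAt W (W' s) s) (hWtop : Tendsto W atTop atTop)
    (h1 : Tendsto (fun s => W s * (W' s - D)) atTop (𝓝 (D * B)))
    (h2 : Tendsto (fun s => W s * (W s * (W' s - D) - D * B)) atTop (𝓝 (D * C))) :
    ∃ K, Tendsto (fun s => W s - D * s - B * log s) atTop (𝓝 K) ∧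
      Tendsto (fun s => s * (W s - D * s - B * log s - K) - B ^ 2 / D * log s) atTop
        (𝓝 ((B ^ 2 + B * K - C) / D)) := by
  have hWinv : Tendsto (fun s => (W s)⁻¹) atTop (𝓝 0) := tendsto_inv_atTop_zero.comp hWtop
  have hWpos : ∀ᶠ s in atTop, 0 < W s := hWtop.eventually_gt_atTop 0
  have hW'lim : Tendsto W' atTop (𝓝 D) := by
    have := (hWinv.mul h1).add_const D
    rw [zero_mul, zero_add] at this
    refine this.congr' ?_
    filter_upwards [hWpos] with s hs
    field_simp
    ring
  have hWge : ∀ᶠ s in atTop, D / 4 * s ≤ W s := by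
    obtain ⟨s₀, hs₀⟩ := exists_linear_le_of_eventually_le_deriv (δ := D / 2) hW
      (hW'lim.eventually (le_mem_nhds (by linarith)))
    have hl : Tendsto (fun s => D / 4 * s) atTop atTop :=
      tendsto_id.const_mul_atTop (by positivity)
    filter_upwards [eventually_ge_atTop s₀, hl.eventually_ge_atTop (D / 2 * s₀ - W s₀)]
      with s hs hs'
    have := hs₀ s hs
    linarith
  set z : ℝ → ℝ := fun s => W s - D * s with hz
  have hzd : ∀ s, HasDerivAt z (W' s - D) s := fun s =>
    ((hW s).sub ((hasDerivAt_id s).const_mul D)).congr_deriv (by simp)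
  -- `z' = O(1/s)` gives more than `z = O(√s)`, but this suffices for an integrable `H'`.
  obtain ⟨C₁, hC₁, hzle⟩ : ∃ C₁ : ℝ, 0 < C₁ ∧ ∀ᶠ s in atTop, |z s| ≤ C₁ * √s := by
    set C₀ := (|D * B| + 1) * (4 / D) with hC₀
    have hC₀pos : 0 < C₀ := by positivity
    have hev : ∀ᶠ s in atTop, |W' s - D| ≤ 2 * C₀ * (1 / (2 * √s)) := by
      filter_upwards [h1.abs.eventually (ge_mem_nhds (lt_add_one |D * B|)), hWpos, hWge,
        eventually_ge_atTop 1] with s hs hWs hWs' hs1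
      rw [abs_mul, abs_of_pos hWs] at hs
      have hs0 : 0 < s := by linarith
      have hsq : √s ≤ s := by
        rw [sqrt_le_left hs0.le]; nlinarith
      have hsq0 : 0 < √s := sqrt_pos.2 hs0
      have e1 : |W' s - D| ≤ (|D * B| + 1) / W s := by
        rw [le_div_iff₀ hWs]; linarith
      have e2 : (|D * B| + 1) / W s ≤ (|D * B| + 1) / (D / 4 * √s) := by
        gcongr
        exact (mul_le_mul_of_nonneg_left hsq (by positivity)).trans hWs'
      refine (e1.trans e2).trans (le_of_eq ?_)
      rw [hC₀]
      field_simp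
    obtain ⟨s₀, hs₀⟩ := eventually_atTop.1 (hev.and (eventually_ge_atTop 1))
    refine ⟨|z s₀| + 2 * C₀, by positivity, ?_⟩
    filter_upwards [eventually_ge_atTop s₀] with s hs
    have e1 := abs_sub_le_of_abs_deriv_le (g := fun s => 2 * C₀ * √s) (fun s _ => hzd s)
      (fun s hs' => (hasDerivAt_sqrt (by linarith [(hs₀ s hs').2])).const_mul (2 * C₀))
      (fun s hs' => (hs₀ s hs').1) hs
    have e2 : 1 ≤ √s := one_le_sqrt.2 (hs₀ s hs).2
    have e3 := abs_sub_abs_le_abs_sub (z s) (z s₀)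
    have e4 : 0 ≤ 2 * C₀ * √s₀ := by positivity
    have e5 := mul_le_mul_of_nonneg_left e2 (abs_nonneg (z s₀))
    linarith
  set H : ℝ → ℝ := fun s => z s - B * log s with hH
  set y : ℝ → ℝ := fun s => W s * (W s * (W' s - D) - D * B) with hy
  have hHd : ∀ s, 0 < s → HasDerivAt H (W' s - D - B / s) s := fun s hs =>
    ((hzd s).sub ((hasDerivAt_log hs.ne').const_mul B)).congr_deriv (by ring)
  have hH' : ∀ s, 0 < s → 0 < W s →
      W' s - D - B / s = -(B * z s / (W s * s)) + y s / W s ^ 2 := fun s hs hWs => by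
    simp only [hy, hz]
    field_simp
    ring
  obtain ⟨K, hK⟩ : ∃ K, Tendsto H atTop (𝓝 K) := by
    obtain ⟨s₀, hs₀⟩ := eventually_atTop.1 (((hzle.and hWge).and (eventually_ge_atTop 1)).and
      (h2.abs.eventually (ge_mem_nhds (lt_add_one |D * C|))))
    have hs₀pos : 0 < s₀ := by linarith [(hs₀ s₀ le_rfl).1.2]
    set C₂ := |B| * C₁ * (4 / D) + (|D * C| + 1) * (4 / D) ^ 2 with hC₂
    have hint : MeasureTheory.IntegrableOn (deriv H) (Ioi s₀) := by
      refine MeasureTheory.Integrable.mono'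
        ((integrableOn_Ioi_rpow_of_lt (by norm_num : (-3 / 2 : ℝ) < -1) hs₀pos).const_mul C₂)
        (measurable_deriv H).aestronglyMeasurable ?_
      filter_upwards [MeasureTheory.ae_restrict_mem measurableSet_Ioi] with s hs
      obtain ⟨⟨⟨hzs, hWs⟩, hs1⟩, hys⟩ := hs₀ s (le_of_lt hs)
      have hs0 : 0 < s := by linarith
      have hWs0 : 0 < W s := lt_of_lt_of_le (by positivity) hWs
      rw [(hHd s hs0).deriv, hH' s hs0 hWs0, Real.norm_eq_abs]
      have hsq0 : 0 < √s := sqrt_pos.2 hs0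
      have hss : √s * √s = s := mul_self_sqrt hs0.le
      have hpow : s ^ (-3 / 2 : ℝ) = √s / (s * s) := by
        rw [show (-3 / 2 : ℝ) = 1 / 2 - 2 by norm_num, rpow_sub hs0, ← sqrt_eq_rpow]
        norm_num [sq]
      have e1 : |B * z s / (W s * s)| ≤ |B| * C₁ * (4 / D) * (√s / (s * s)) := by
        rw [abs_div, abs_mul, abs_of_pos (by positivity : 0 < W s * s)]
        calc |B| * |z s| / (W s * s) ≤ |B| * (C₁ * √s) / (D / 4 * s * s) := by gcongr
          _ = _ := by field_simp
      have e2 : |y s / W s ^ 2| ≤ (|D * C| + 1) * (4 / D) ^ 2 * (√s / (s * s)) := by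
        rw [abs_div, abs_of_pos (by positivity : 0 < W s ^ 2)]
        calc |y s| / W s ^ 2 ≤ (|D * C| + 1) / (D / 4 * s) ^ 2 := by gcongr
          _ = (|D * C| + 1) * (4 / D) ^ 2 * (1 / (s * s)) := by field_simp
          _ ≤ _ := by gcongr; exact one_le_sqrt.2 hs1
      rw [hpow]
      refine (abs_add_le _ _).trans ?_
      rw [abs_neg, hC₂, add_mul]
      exact add_le_add e1 e2
    refine ⟨_, MeasureTheory.tendsto_limUnder_of_hasDerivAt_of_integrableOn_Ioi
      (fun s hs => ?_) hint⟩
    exact (hHd s (hs₀pos.trans hs)).differentiableAt.hasDerivAt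
  refine ⟨K, hK, ?_⟩
  have hinv_sqrt : Tendsto (fun s : ℝ => (√s)⁻¹) atTop (𝓝 0) :=
    tendsto_inv_atTop_zero.comp tendsto_sqrt_atTop
  have hzsqrt : Tendsto (fun s => z s / √s) atTop (𝓝 0) := by
    have := (hK.mul hinv_sqrt).add (tendsto_log_div_sqrt.const_mul B)
    rw [mul_zero, mul_zero, add_zero] at this
    refine this.congr fun s => ?_
    simp only [hH]
    ring
  -- `s/W - 1/D = -z/(WD)`, so `z s/W` differs from `z/D` by a multiple of `(z²/s)(s/W) → 0`.
  have hzsq : Tendsto (fun s => z s ^ 2 / s) atTop (𝓝 0) := by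
    have := hzsqrt.pow 2
    rw [zero_pow two_ne_zero] at this
    refine this.congr' ?_
    filter_upwards [eventually_ge_atTop 0] with s hs
    rw [div_pow, sq_sqrt hs]
  have hzs : Tendsto (fun s => z s / s) atTop (𝓝 0) := by
    have := hzsqrt.mul hinv_sqrt
    rw [mul_zero] at this
    refine this.congr' ?_
    filter_upwards [eventually_ge_atTop 0] with s hs
    rw [← div_eq_mul_inv, div_div, mul_self_sqrt hs]
  have hsW : Tendsto (fun s => s / W s) atTop (𝓝 D⁻¹) := by
    have := (hzs.const_add D).inv₀ (by simpa using hD.ne')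
    rw [add_zero] at this
    refine this.congr' ?_
    filter_upwards [eventually_gt_atTop 0] with s hs
    have : D + z s / s = W s / s := by simp only [hz]; field_simp; ring
    rw [this, inv_div]
  have hlogs : Tendsto (fun s => log s / s) atTop (𝓝 0) := by
    have := tendsto_log_div_sqrt.mul hinv_sqrt
    rw [mul_zero] at this
    refine this.congr' ?_
    filter_upwards [eventually_ge_atTop 0] with s hs
    rw [← div_eq_mul_inv, div_div, mul_self_sqrt hs]
  have hlh := HasDerivAt.lhopital_zero_atTop (l := 𝓝 ((B ^ 2 + B * K - C) / D))
    (f := fun s => H s - K - B ^ 2 / D * (log s / s)) (g := fun s => s⁻¹)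
    (f' := fun s => W' s - D - B / s - B ^ 2 / D * ((1 - log s) / s ^ 2))
    (g' := fun s => -(s ^ 2)⁻¹)
    (by
      filter_upwards [eventually_gt_atTop 0] with s hs
      refine (((hHd s hs).sub_const K).sub
        (((hasDerivAt_log hs.ne').div (hasDerivAt_id s) hs.ne').const_mul
          (B ^ 2 / D))).congr_deriv ?_
      simp [hs.ne'])
    (by
      filter_upwards [eventually_gt_atTop 0] with s hs
      exact hasDerivAt_inv hs.ne')
    (by
      filter_upwards [eventually_gt_atTop 0] with s hs
      exact neg_ne_zero.2 (inv_ne_zero (pow_ne_zero 2 hs.ne')))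
    (by simpa using (hK.sub_const K).sub (hlogs.const_mul (B ^ 2 / D)))
    tendsto_inv_atTop_zero
    (by
      have e1 := (hK.const_mul (B / D)).sub ((hzsq.mul hsW).const_mul (B / D))
      have e2 := (e1.sub (h2.mul (hsW.pow 2))).add_const (B ^ 2 / D)
      have e3 : B / D * K - B / D * (0 * D⁻¹) - D * C * D⁻¹ ^ 2 + B ^ 2 / D
          = (B ^ 2 + B * K - C) / D := by field_simp; ring
      rw [e3] at e2
      refine e2.congr' ?_
      filter_upwards [eventually_gt_atTop 0, hWpos] with s hs hWs
      rw [hH' s hs hWs]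
      have hWz : W s = D * s + z s := by simp only [hz]; ring
      simp only [hH]
      have hne : D * s + z s ≠ 0 := by rw [← hWz]; exact hWs.ne'
      rw [hWz]
      field_simp
      ring)
  refine hlh.congr' ?_
  filter_upwards [eventually_gt_atTop 0] with s hs
  simp only [hH, hz]
  field_simp

namespace IsOrbit

variable {a κ k p : ℝ} {V Y : ℝ → ℝ}

/-- The derivative of `V` is positive: it behaves like `κ e^{κs}` at `-∞`, and at a zero of it the
second derivative would be `aκV > 0`. -/
lemma deriv_fst_pos (h : IsOrbit a κ k p V Y) (ha : 0 < a) (hκ : 0 < κ) (hk : 0 < k) (hp : 1 < p)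
    (s : ℝ) : 0 < (κ - a) * V s - k * V s ^ p + Y s := by
  set U : ℝ → ℝ := fun s => (κ - a) * V s - k * V s ^ p + Y s with hU
  have hUd : ∀ s, HasDerivAt U ((κ - a) * U s - k * (U s * p * V s ^ (p - 1)) + a * κ * V s) s :=
    fun s => (((h.hasDerivAt_fst s).const_mul (κ - a)).sub
      (((h.hasDerivAt_fst s).rpow_const (p := p) (Or.inl (h.pos s).ne')).const_mul k)).add
      (h.hasDerivAt_snd s)
  have hlim : Tendsto (fun s => exp (-κ * s) * U s) atBot (𝓝 κ) := by
    have h0 : Tendsto (fun s => exp (-κ * s) * V s ^ p) atBot (𝓝 0) := by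
      have e1 := (tendsto_exp_mul_atBot (mul_pos (by linarith : 0 < p - 1) hκ)).mul
        (h.tendsto_fst.rpow_const (p := p) (Or.inl one_ne_zero))
      rw [zero_mul] at e1
      refine e1.congr fun s => ?_
      rw [mul_rpow (exp_pos _).le (h.pos s).le, ← exp_mul, ← mul_assoc, ← exp_add]
      ring_nf
    have e2 := ((h.tendsto_fst.const_mul (κ - a)).sub (h0.const_mul k)).add
      (h.tendsto_snd ha hκ hk hp)
    have e3 : (κ - a) * 1 - k * 0 + a = κ := by ring
    rw [e3] at e2
    exact e2.congr fun s => by simp only [hU]; ring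
  obtain ⟨s₀, hs₀⟩ := eventually_atBot.1 (hlim.eventually (lt_mem_nhds hκ))
  have hneg : ∀ t, t ≤ s₀ → 0 < U t := fun t ht =>
    (mul_pos_iff_of_pos_left (exp_pos _)).1 (hs₀ t ht)
  rcases le_total s s₀ with hs | hs
  · exact hneg s hs
  · refine pos_of_first_zero hUd (hneg s₀ le_rfl) (fun t _ _ ht => ?_) s hs
    have := h.pos t
    rw [ht]
    simp only [mul_zero, zero_mul, sub_zero, zero_add]
    positivity

lemma tendsto_fst_atTop (h : IsOrbit a κ k p V Y) (ha : 0 < a) (hκ : 0 < κ) (hk : 0 < k)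
    (hp : 1 < p) : Tendsto V atTop atTop := by
  have hmono : StrictMono V := strictMono_of_deriv_pos fun s => by
    rw [(h.hasDerivAt_fst s).deriv]
    exact h.deriv_fst_pos ha hκ hk hp s
  -- If `V` were bounded, then `Y' = aκV` would force `Y`, hence `V'`, to infinity.
  rcases tendsto_atTop_of_monotone hmono.monotone with h1 | ⟨l, hl⟩
  · exact h1
  · have hY : Tendsto Y atTop atTop :=
      tendsto_atTop_of_eventually_le_deriv (δ := a * κ * V 0)
        (by have := h.pos 0; positivity) h.hasDerivAt_snd
        ((eventually_ge_atTop 0).mono fun s hs =>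
          mul_le_mul_of_nonneg_left (hmono.monotone hs) (by positivity))
    have hlp : 0 < l := (h.pos 0).trans_le (hmono.monotone.ge_of_tendsto hl 0)
    have hU := ((hl.const_mul (κ - a)).sub
      ((hl.rpow_const (p := p) (Or.inl hlp.ne')).const_mul k)).add_atTop hY
    exact tendsto_atTop_of_eventually_le_deriv one_pos h.hasDerivAt_fst
      (hU.eventually_ge_atTop 1)

theorem exists_expansion (h : IsOrbit a κ k p V Y) (ha : 0 < a) (hκ : 0 < κ) (hk : 0 < k)
    (hp : 1 < p) {D B : ℝ} (hD : D = (p - 1) * (a * κ) / (k * p)) (hB : B = (κ - a) / (k * p)) :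
    ∃ K, Tendsto (fun s => V s ^ (p - 1) - D * s - B * log s) atTop (𝓝 K) ∧
      Tendsto (fun s => s * (V s ^ (p - 1) - D * s - B * log s - K) - B ^ 2 / D * log s) atTop
        (𝓝 (B * K / D - (p - 2) / ((p - 1) * (k * p)))) := by
  have hp1 : 0 < p - 1 := by linarith
  set U : ℝ → ℝ := fun s => (κ - a) * V s - k * V s ^ p + Y s with hU
  have hUpos : ∀ s, 0 < U s := h.deriv_fst_pos ha hκ hk hp
  have hUd : ∀ s, HasDerivAt U ((κ - a) * U s - k * (U s * p * V s ^ (p - 1)) + a * κ * V s) s :=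
    fun s => (((h.hasDerivAt_fst s).const_mul (κ - a)).sub
      (((h.hasDerivAt_fst s).rpow_const (p := p) (Or.inl (h.pos s).ne')).const_mul k)).add
      (h.hasDerivAt_snd s)
  set W : ℝ → ℝ := fun s => V s ^ (p - 1) with hWdef
  set e : ℝ → ℝ := fun s => U s / V s with hedef
  have hW : ∀ s, HasDerivAt W ((p - 1) * (W s * e s)) s := fun s => by
    refine ((h.hasDerivAt_fst s).rpow_const (p := p - 1) (Or.inl (h.pos s).ne')).congr_deriv ?_
    simp only [hWdef, hedef]
    rw [rpow_sub_one (h.pos s).ne' (p - 1)]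
    ring
  have he : ∀ s, HasDerivAt e
      (a * κ + (κ - a) * e s - e s ^ 2 - (k * p) * W s * e s) s := fun s => by
    refine ((hUd s).div (h.hasDerivAt_fst s) (h.pos s).ne').congr_deriv ?_
    have hV := (h.pos s).ne'
    change _ = a * κ + (κ - a) * (U s / V s) - (U s / V s) ^ 2 - (k * p) * W s * (U s / V s)
    change (((κ - a) * U s - k * (U s * p * W s) + a * κ * V s) * V s - U s * U s) / V s ^ 2 = _
    field_simp
    ring
  have hWtop : Tendsto W atTop atTop :=
    (tendsto_rpow_atTop hp1).comp (h.tendsto_fst_atTop ha hκ hk hp)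
  have hkp : 0 < k * p := by positivity
  obtain ⟨r1, r2⟩ := riccati_expansion hkp hW he (fun s => div_pos (hUpos s) (h.pos s)) hWtop
  have hDpos : 0 < D := by rw [hD]; positivity
  have hp1' := hp1.ne'
  obtain ⟨K, hK1, hK2⟩ := exists_expansion_of_deriv (D := D) (B := B)
    (C := B ^ 2 + (p - 2) * (a * κ) / (k * p) ^ 2) hDpos hW hWtop
    (by
      have e1 : D * B = (p - 1) * ((κ - a) * (a * κ / (k * p)) / (k * p)) := by
        rw [hD, hB]; ring
      rw [e1]
      refine (r1.const_mul (p - 1)).congr fun s => ?_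
      rw [hD]; ring)
    (by
      have e1 : D * (B ^ 2 + (p - 2) * (a * κ) / (k * p) ^ 2) = (p - 1) *
          (((κ - a) * ((κ - a) * (a * κ / (k * p)) / (k * p))
            + (p - 1 - 1) * (a * κ / (k * p)) ^ 2) / (k * p)) := by
        rw [hD, hB]; field_simp; ring
      rw [e1]
      refine (r2.const_mul (p - 1)).congr fun s => ?_
      rw [hD, hB]; ring)
  refine ⟨K, hK1, ?_⟩
  have e1 : (B ^ 2 + B * K - (B ^ 2 + (p - 2) * (a * κ) / (k * p) ^ 2)) / D
      = B * K / D - (p - 2) / ((p - 1) * (k * p)) := by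
    have : (p - 2) * (a * κ) / (k * p) ^ 2 = D * ((p - 2) / ((p - 1) * (k * p))) := by
      rw [hD]; field_simp
    rw [this]
    field_simp
    ring
  rw [← e1]
  exact hK2

end IsOrbit

/-! ### The Emden–Fowler change of variables -/

lemma IsOrbit.contDiff {a κ k p : ℝ} {V Y : ℝ → ℝ} (h : IsOrbit a κ k p V Y) :
    ContDiff ℝ 2 V := by
  have hVdiff : Differentiable ℝ V := fun s => (h.hasDerivAt_fst s).differentiableAt
  have hYdiff : Differentiable ℝ Y := fun s => (h.hasDerivAt_snd s).differentiableAt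
  have hVd : deriv V = fun s => (κ - a) * V s - k * V s ^ p + Y s :=
    funext fun s => (h.hasDerivAt_fst s).deriv
  have hYd : deriv Y = fun s => a * κ * V s := funext fun s => (h.hasDerivAt_snd s).deriv
  have hY1 : ContDiff ℝ 1 Y := contDiff_one_iff_deriv.2 ⟨hYdiff, by
    rw [hYd]; exact hVdiff.continuous.const_mul _⟩
  have hV1 : ContDiff ℝ 1 V := contDiff_one_iff_deriv.2 ⟨hVdiff, by
    rw [hVd]
    exact ((hVdiff.continuous.const_mul _).sub ((hVdiff.continuous.rpow_const
      fun s => Or.inl (h.pos s).ne').const_mul _)).add hYdiff.continuous⟩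
  have : ContDiff ℝ (1 + 1) V := contDiff_succ_iff_deriv.2 ⟨hVdiff, by simp, by
    rw [hVd]
    exact ((contDiff_const.mul hV1).sub (contDiff_const.mul
      (hV1.rpow_const_of_ne fun s => (h.pos s).ne'))).add hY1⟩
  exact this

/-- The left-hand side of `((n-1)/m) (Δφ^m)(r) + β r^P (ν φ + r φ_r) = 0`. The profile equation is
the case `P = 0`, `ν = 2/(1-m)`, and the inverted equation the case
`P = (n-2)/m - n - 2`, `β = 1`, `ν = γ₁`. -/
def weightedResidual (n : ℕ) (m P β ν : ℝ) (φ : ℝ → ℝ) (r : ℝ) : ℝ :=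
  ((n : ℝ) - 1) / m * radialLaplacian n (fun x => φ x ^ m) r
    + β * r ^ P * (ν * φ r + r * deriv φ r)

/-- The relations between parameters under which `emden` takes the equation `weightedResidual = 0` to
the Liénard system of `IsOrbit` with `k = m/(n-1)` and `p = 1/m`. The sign `σ = ±1` is the direction
in which `s` runs through `log r`. -/
structure EmdenParams (n : ℕ) (m a κ P β ν μ lam σ : ℝ) : Prop where
  one_lt : 1 < (n : ℝ)
  m_pos : 0 < m
  scale_pos : 0 < μ
  lam_pos : 0 < lam
  sign_sq : σ * σ = 1
  normalized : σ * β * μ ^ m = μ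
  exponent : ν * m + 2 + P = ν
  linear_coeff : κ - a = -σ * (n - 2 - 2 * (ν * m))
  const_coeff : a * κ = ν * m * (n - 2 - ν * m)

/-- The Emden–Fowler transform `V(s) = (μ ρ^ν φ(ρ))^m`, `ρ = λ e^{σs}`, of a function `φ` on
`(0,∞)`. -/
def emden (m ν μ lam σ : ℝ) (φ : ℝ → ℝ) (s : ℝ) : ℝ :=
  (μ * (lam * exp (σ * s)) ^ ν * φ (lam * exp (σ * s))) ^ m

/-- The inverse of `emden`, with `s = σ log (r/λ)` as `σ² = 1`. -/
def invEmden (m ν μ lam σ : ℝ) (V : ℝ → ℝ) (r : ℝ) : ℝ :=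
  μ⁻¹ * r ^ (-ν) * V (σ * log (r / lam)) ^ (1 / m)

namespace EmdenParams

variable {n : ℕ} {m a κ P β ν μ lam σ : ℝ} {φ V Y : ℝ → ℝ}

lemma exists_radius (h : EmdenParams n m a κ P β ν μ lam σ) {r : ℝ} (hr : 0 < r) :
    lam * exp (σ * (σ * log (r / lam))) = r := by
  rw [← mul_assoc, h.sign_sq, one_mul, exp_log (div_pos hr h.lam_pos)]
  have := h.lam_pos.ne'
  field_simp

lemma emden_invEmden (h : EmdenParams n m a κ P β ν μ lam σ) (hV : ∀ s, 0 < V s) (s : ℝ) :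
    emden m ν μ lam σ (invEmden m ν μ lam σ V) s = V s := by
  have hlam := h.lam_pos
  have hρ : 0 < lam * exp (σ * s) := mul_pos hlam (exp_pos _)
  have hlog : σ * log (lam * exp (σ * s) / lam) = s := by
    rw [mul_div_cancel_left₀ _ hlam.ne', log_exp, ← mul_assoc, h.sign_sq, one_mul]
  have h1 : (lam * exp (σ * s)) ^ ν * (lam * exp (σ * s)) ^ (-ν) = 1 := by
    rw [← rpow_add hρ]; simp
  have h2 : μ * (lam * exp (σ * s)) ^ ν * (μ⁻¹ * (lam * exp (σ * s)) ^ (-ν) * V s ^ (1 / m))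
      = V s ^ (1 / m) := by
    rw [show μ * (lam * exp (σ * s)) ^ ν * (μ⁻¹ * (lam * exp (σ * s)) ^ (-ν) * V s ^ (1 / m))
      = (μ * μ⁻¹) * ((lam * exp (σ * s)) ^ ν * (lam * exp (σ * s)) ^ (-ν)) * V s ^ (1 / m) by ring,
      h1, mul_inv_cancel₀ h.scale_pos.ne', one_mul, one_mul]
  rw [emden, invEmden, hlog, h2, ← rpow_mul (hV s).le, one_div_mul_cancel h.m_pos.ne', rpow_one]

lemma invEmden_emden (h : EmdenParams n m a κ P β ν μ lam σ) (hφ : ∀ r, 0 < r → 0 < φ r) {r : ℝ}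
    (hr : 0 < r) : invEmden m ν μ lam σ (emden m ν μ lam σ φ) r = φ r := by
  have hμ := h.scale_pos
  have h0 := hφ r hr
  have h1 : r ^ (-ν) * r ^ ν = 1 := by
    rw [← rpow_add hr]; simp
  have h2 : 0 ≤ μ * r ^ ν * φ r := by have := rpow_pos_of_pos hr ν; positivity
  rw [invEmden, emden, h.exists_radius hr, ← rpow_mul h2, mul_one_div_cancel h.m_pos.ne', rpow_one,
    show μ⁻¹ * r ^ (-ν) * (μ * r ^ ν * φ r) = (μ⁻¹ * μ) * (r ^ (-ν) * r ^ ν) * φ r by ring,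
    h1, inv_mul_cancel₀ hμ.ne', one_mul, one_mul]

lemma emden_pos (h : EmdenParams n m a κ P β ν μ lam σ) (hφ : ∀ r, 0 < r → 0 < φ r) (s : ℝ) :
    0 < emden m ν μ lam σ φ s := by
  have hρ : 0 < lam * exp (σ * s) := mul_pos h.lam_pos (exp_pos _)
  exact rpow_pos_of_pos (mul_pos (mul_pos h.scale_pos (rpow_pos_of_pos hρ _)) (hφ _ hρ)) _

lemma invEmden_pos (h : EmdenParams n m a κ P β ν μ lam σ) (hV : ∀ s, 0 < V s) {r : ℝ}
    (hr : 0 < r) : 0 < invEmden m ν μ lam σ V r :=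
  mul_pos (mul_pos (inv_pos.2 h.scale_pos) (rpow_pos_of_pos hr _)) (rpow_pos_of_pos (hV _) _)

lemma contDiffOn_invEmden (h : EmdenParams n m a κ P β ν μ lam σ) (hV : ∀ s, 0 < V s)
    (hVc : ContDiff ℝ 2 V) : ContDiffOn ℝ 2 (invEmden m ν μ lam σ V) (Ioi 0) := by
  have hlog : ContDiffOn ℝ 2 (fun r => σ * log (r / lam)) (Ioi 0) :=
    contDiffOn_const.mul ((contDiffOn_id.div_const lam).log fun r hr =>
      (div_pos hr h.lam_pos).ne')
  have h1 : ContDiffOn ℝ 2 (fun r => V (σ * log (r / lam)) ^ (1 / m)) (Ioi 0) :=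
    (hVc.comp_contDiffOn hlog).rpow_const_of_ne fun r _ => (hV _).ne'
  have h2 : ContDiffOn ℝ 2 (fun r : ℝ => r ^ (-ν)) (Ioi 0) :=
    contDiffOn_id.rpow_const_of_ne fun r hr => (ne_of_gt hr)
  exact (contDiffOn_const.mul h2).mul h1

/-- The transform of an arbitrary positive `C²` function `φ` satisfies the first equation of the
Liénard system with some `Z`, and the second one up to a positive multiple of the residual of `φ`.
Both directions of the correspondence between solutions follow from this. -/
lemma exists_hasDerivAt_emden (h : EmdenParams n m a κ P β ν μ lam σ)
    (hφ : ∀ r, 0 < r → 0 < φ r) (hc : ContDiffOn ℝ 2 φ (Ioi 0)) :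
    ∃ Z : ℝ → ℝ,
      (∀ s, HasDerivAt (emden m ν μ lam σ φ) ((κ - a) * emden m ν μ lam σ φ s
        - m / (n - 1) * emden m ν μ lam σ φ s ^ (1 / m) + Z s) s) ∧
      ∀ s, HasDerivAt Z (a * κ * emden m ν μ lam σ φ s
        + μ ^ m * (lam * exp (σ * s)) ^ (ν * m + 2) * (m / (n - 1))
          * weightedResidual n m P β ν φ (lam * exp (σ * s))) s := by
  set G : ℝ → ℝ := fun x => φ x ^ m with hG
  set ρ : ℝ → ℝ := fun s => lam * exp (σ * s) with hρdef
  have hρ : ∀ s, 0 < ρ s := fun s => mul_pos h.lam_pos (exp_pos _)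
  have hρd : ∀ s, HasDerivAt ρ (σ * ρ s) s := fun s =>
    ((hasDerivAt_exp_mul σ s).const_mul lam).congr_deriv (by simp only [hρdef]; ring)
  have hρpow : ∀ c s, HasDerivAt (fun s => ρ s ^ c) (σ * c * ρ s ^ c) s := fun c s => by
    refine ((hρd s).rpow_const (p := c) (Or.inl (hρ s).ne')).congr_deriv ?_
    rw [rpow_sub_one (hρ s).ne']
    have := (hρ s).ne'
    field_simp
  have hGc : ContDiffOn ℝ 2 G (Ioi 0) := hc.rpow_const_of_ne fun r hr => (hφ r hr).ne'
  have hG'c : ContDiffOn ℝ 1 (deriv G) (Ioi 0) :=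
    hGc.deriv_of_isOpen isOpen_Ioi (by norm_num)
  have hφd : ∀ r, 0 < r → HasDerivAt φ (deriv φ r) r := fun r hr =>
    ((hc.differentiableOn (by norm_num)).differentiableAt (Ioi_mem_nhds hr)).hasDerivAt
  have hGd : ∀ r, 0 < r → HasDerivAt G (deriv G r) r := fun r hr =>
    ((hGc.differentiableOn (by norm_num)).differentiableAt (Ioi_mem_nhds hr)).hasDerivAt
  have hG'd : ∀ r, 0 < r → HasDerivAt (deriv G) (deriv (deriv G) r) r := fun r hr =>
    ((hG'c.differentiableOn (by norm_num)).differentiableAt (Ioi_mem_nhds hr)).hasDerivAt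
  set V := emden m ν μ lam σ φ with hVdef
  have hμ := h.scale_pos
  have hm := h.m_pos
  have hn1 : (n : ℝ) - 1 ≠ 0 := by linarith [h.one_lt]
  have hV : V = fun s => μ ^ m * ρ s ^ (ν * m) * G (ρ s) := funext fun s => by
    have h1 : 0 ≤ ρ s ^ ν := rpow_nonneg (hρ s).le _
    change (μ * ρ s ^ ν * φ (ρ s)) ^ m = _
    rw [mul_rpow (by positivity) (hφ _ (hρ s)).le, mul_rpow hμ.le h1, ← rpow_mul (hρ s).le]
  have hVp : ∀ s, V s ^ (1 / m) = μ * ρ s ^ ν * φ (ρ s) := fun s => by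
    have h1 : 0 ≤ ρ s ^ ν := rpow_nonneg (hρ s).le _
    have h2 := (hφ _ (hρ s)).le
    change ((μ * ρ s ^ ν * φ (ρ s)) ^ m) ^ (1 / m) = _
    rw [← rpow_mul (by positivity), mul_one_div_cancel hm.ne', rpow_one]
  set V₁ : ℝ → ℝ := fun s => σ * (ν * m * V s + μ ^ m * (ρ s ^ (ν * m + 1) * deriv G (ρ s)))
    with hV₁
  have hVd : ∀ s, HasDerivAt V (V₁ s) s := fun s => by
    simp only [hV₁, hV]
    refine (((hρpow (ν * m) s).const_mul (μ ^ m)).mul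
      ((hGd _ (hρ s)).comp s (hρd s))).congr_deriv ?_
    rw [rpow_add_one (hρ s).ne']
    simp only [Function.comp_apply]
    ring
  refine ⟨fun s => V₁ s - (κ - a) * V s + m / (n - 1) * (μ * ρ s ^ ν * φ (ρ s)), fun s => ?_,
    fun s => ?_⟩
  · refine (hVd s).congr_deriv ?_
    rw [hVp]
    ring
  · have d1 := (((hVd s).const_mul (ν * m)).add ((((hρpow (ν * m + 1) s).mul
      ((hG'd _ (hρ s)).comp s (hρd s)))).const_mul (μ ^ m))).const_mul σ
    have d2 := (((hρpow ν s).const_mul μ).mul ((hφd _ (hρ s)).comp s (hρd s))).const_mul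
      (m / ((n : ℝ) - 1))
    refine ((d1.sub ((hVd s).const_mul (κ - a))).add d2).congr_deriv ?_
    have hlc := h.linear_coeff
    have hcc := h.const_coeff
    have hσ := h.sign_sq
    have hnrm := h.normalized
    have e1 : ρ s ^ (ν * m + 1) = ρ s ^ (ν * m) * ρ s := rpow_add_one (hρ s).ne' _
    have e2 : ρ s ^ (ν * m + 2) = ρ s ^ (ν * m) * ρ s ^ 2 := by
      rw [rpow_add (hρ s)]; norm_num
    have e3 : ρ s ^ (ν * m) * ρ s ^ 2 * ρ s ^ P = ρ s ^ ν := by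
      rw [← e2, ← rpow_add (hρ s), h.exponent]
    have e4 : weightedResidual n m P β ν φ (lam * exp (σ * s)) = ((n : ℝ) - 1) / m *
        (deriv (deriv G) (ρ s) + ((n : ℝ) - 1) / ρ s * deriv G (ρ s))
        + β * ρ s ^ P * (ν * φ (ρ s) + ρ s * deriv φ (ρ s)) := rfl
    rw [e4]
    simp only [Function.comp_apply, hV₁]
    change _ = a * κ * V s + μ ^ m * ρ s ^ (ν * m + 2) * _ * _
    rw [e1, e2, hcc, hlc]
    have hρ0 := (hρ s).ne'
    have e5 : μ ^ m * (ρ s ^ (ν * m) * ρ s ^ 2) * (m / ((n : ℝ) - 1)) * (((n : ℝ) - 1) / m *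
        (deriv (deriv G) (ρ s) + ((n : ℝ) - 1) / ρ s * deriv G (ρ s))
        + β * ρ s ^ P * (ν * φ (ρ s) + ρ s * deriv φ (ρ s)))
        = μ ^ m * ρ s ^ (ν * m) * (ρ s ^ 2 * deriv (deriv G) (ρ s)
          + ((n : ℝ) - 1) * ρ s * deriv G (ρ s))
        + m / ((n : ℝ) - 1) * (σ * σ) * (β * μ ^ m) *
          (ρ s ^ (ν * m) * ρ s ^ 2 * ρ s ^ P) * (ν * φ (ρ s) + ρ s * deriv φ (ρ s)) := by
      rw [hσ]
      field_simp
    rw [e5, e3]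
    linear_combination
      (ν * m * (ν * m * V s + μ ^ m * (ρ s ^ (ν * m) * ρ s * deriv G (ρ s)))
        + μ ^ m * ((ν * m + 1) * (ρ s ^ (ν * m) * ρ s) * deriv G (ρ s)
          + ρ s ^ (ν * m) * ρ s * ρ s * deriv (deriv G) (ρ s))
        + ((n : ℝ) - 2 - 2 * (ν * m)) *
          (ν * m * V s + μ ^ m * (ρ s ^ (ν * m) * ρ s * deriv G (ρ s)))) * hσ
      - m / ((n : ℝ) - 1) * σ * ρ s ^ ν * (ν * φ (ρ s) + ρ s * deriv φ (ρ s)) * hnrm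

theorem exists_isOrbit (h : EmdenParams n m a κ P β ν μ lam σ)
    (hφ : ∀ r, 0 < r → 0 < φ r) (hc : ContDiffOn ℝ 2 φ (Ioi 0))
    (hode : ∀ r, 0 < r → weightedResidual n m P β ν φ r = 0)
    (hlim : Tendsto (fun s => exp (-κ * s) * emden m ν μ lam σ φ s) atBot (𝓝 1)) :
    ∃ Z, IsOrbit a κ (m / (n - 1)) (1 / m) (emden m ν μ lam σ φ) Z := by
  obtain ⟨Z, h1, h2⟩ := h.exists_hasDerivAt_emden hφ hc
  refine ⟨Z, h.emden_pos hφ, h1, fun s => (h2 s).congr_deriv ?_, hlim⟩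
  rw [hode _ (mul_pos h.lam_pos (exp_pos _))]
  ring

theorem weightedResidual_invEmden (h : EmdenParams n m a κ P β ν μ lam σ)
    (hV : IsOrbit a κ (m / (n - 1)) (1 / m) V Y) {r : ℝ} (hr : 0 < r) :
    weightedResidual n m P β ν (invEmden m ν μ lam σ V) r = 0 := by
  obtain ⟨Z, h1, h2⟩ := h.exists_hasDerivAt_emden (fun r hr => h.invEmden_pos hV.pos hr)
    (h.contDiffOn_invEmden hV.pos hV.contDiff)
  have hVV : emden m ν μ lam σ (invEmden m ν μ lam σ V) = V :=
    funext (h.emden_invEmden hV.pos)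
  rw [hVV] at h1
  simp only [hVV] at h2
  -- Both `Z` and `Y` are determined by `V` and its derivative, so the residual must vanish.
  have hZY : Z = Y := funext fun s => by
    have := (h1 s).unique (hV.hasDerivAt_fst s)
    linarith
  rw [hZY] at h2
  have h3 := (h2 (σ * log (r / lam))).unique (hV.hasDerivAt_snd _)
  rw [h.exists_radius hr] at h3
  have h4 : 0 < μ ^ m * r ^ (ν * m + 2) * (m / ((n : ℝ) - 1)) :=
    mul_pos (mul_pos (rpow_pos_of_pos h.scale_pos _) (rpow_pos_of_pos hr _))
      (div_pos h.m_pos (by linarith [h.one_lt]))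
  have h5 : μ ^ m * r ^ (ν * m + 2) * (m / ((n : ℝ) - 1)) *
      weightedResidual n m P β ν (invEmden m ν μ lam σ V) r = 0 := by linarith
  exact (mul_eq_zero.1 h5).resolve_left h4.ne'

theorem eqOn_invEmden (h : EmdenParams n m a κ P β ν μ lam σ) (ha : 0 < a) (hκ : 0 < κ)
    (hm1 : m < 1) (hV : IsOrbit a κ (m / (n - 1)) (1 / m) V Y)
    (hφ : ∀ r, 0 < r → 0 < φ r) (hc : ContDiffOn ℝ 2 φ (Ioi 0))
    (hode : ∀ r, 0 < r → weightedResidual n m P β ν φ r = 0)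
    (hlim : Tendsto (fun s => exp (-κ * s) * emden m ν μ lam σ φ s) atBot (𝓝 1)) :
    EqOn φ (invEmden m ν μ lam σ V) (Ioi 0) := by
  obtain ⟨Z, hZ⟩ := h.exists_isOrbit hφ hc hode hlim
  have hk : 0 < m / ((n : ℝ) - 1) := div_pos h.m_pos (by linarith [h.one_lt])
  rw [hV.unique hZ ha hκ hk (one_lt_one_div h.m_pos hm1)]
  exact fun r hr => (h.invEmden_emden hφ hr).symm

end EmdenParams

lemma tendsto_rpow_comp_iff {T ρ : ℝ → ℝ} {m : ℝ} {l l' : Filter ℝ} (hm : 0 < m)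
    (hT : ∀ r, 0 < r → 0 ≤ T r) (hρ : ∀ s, 0 < ρ s) (hl : map ρ l = l') :
    Tendsto (fun s => T (ρ s) ^ m) l (𝓝 1) ↔ Tendsto T l' (𝓝 1) := by
  rw [← hl, tendsto_map'_iff]
  constructor
  · intro h
    have := h.rpow_const (p := 1 / m) (Or.inl one_ne_zero)
    rw [one_rpow] at this
    refine this.congr fun s => ?_
    rw [← rpow_mul (hT _ (hρ s)), mul_one_div_cancel hm.ne', rpow_one]
    rfl
  · intro h
    have := h.rpow_const (p := m) (Or.inl one_ne_zero)
    rwa [one_rpow] at this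

/-! ### Transfer of the expansion to the profiles -/

lemma map_mul_exp_neg_atBot {lam : ℝ} (hlam : 0 < lam) :
    map (fun s => lam * exp (-1 * s)) atBot = atTop := by
  refine le_antisymm ?_ ?_
  · have h1 : Tendsto (fun s : ℝ => -1 * s) atBot atTop := by
      simpa using tendsto_neg_atBot_atTop
    exact (tendsto_exp_atTop.comp h1).const_mul_atTop hlam
  · refine le_map_of_right_inverse (mba := fun r => -log (r / lam)) ?_ ?_
    · filter_upwards [eventually_gt_atTop 0] with r hr
      simp only [Function.comp_apply, neg_mul, one_mul, neg_neg, id]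
      rw [exp_log (div_pos hr hlam)]
      field_simp
    · exact tendsto_neg_atTop_atBot.comp (tendsto_log_atTop.comp
        (tendsto_id.atTop_div_const hlam))

/-- The expansion of `W` at `s = L + ℓ` in terms of `L`: the shift contributes `Dℓ` to the constant
term and, through `B log (L + ℓ)`, also `Bℓ/L`. -/
lemma tendsto_shifted_expansion {W : ℝ → ℝ} {D B K X : ℝ}
    (hX : Tendsto (fun s => s * (W s - D * s - B * log s - K) - B ^ 2 / D * log s) atTop (𝓝 X))
    (ℓ : ℝ) :
    Tendsto (fun L => L * (W (L + ℓ) - D * L - B * log L - (K + D * ℓ)) - B ^ 2 / D * log L)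
      atTop (𝓝 (X + B * ℓ)) := by
  have ht : Tendsto (fun L : ℝ => L + ℓ) atTop atTop := tendsto_atTop_add_const_right _ _ tendsto_id
  have h1 : Tendsto (fun L : ℝ => ℓ / (L + ℓ)) atTop (𝓝 0) := ht.const_div_atTop ℓ
  have h2 : Tendsto (fun L : ℝ => log (L + ℓ) / (L + ℓ)) atTop (𝓝 0) :=
    (isLittleO_log_id_atTop.tendsto_div_nhds_zero).comp ht
  have h3 : Tendsto (fun L : ℝ => L * (log (L + ℓ) - log L)) atTop (𝓝 ℓ) := by
    refine (tendsto_mul_log_one_add_div_atTop ℓ).congr' ?_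
    filter_upwards [eventually_gt_atTop 0, ht.eventually_gt_atTop 0] with L hL hL'
    rw [← log_div hL'.ne' hL.ne']
    congr 2
    field_simp
  have h4 : Tendsto (fun L : ℝ => log (L + ℓ) - log L) atTop (𝓝 0) := by
    have := h3.mul (tendsto_inv_atTop_zero (𝕜 := ℝ))
    rw [mul_zero] at this
    refine this.congr' ?_
    filter_upwards [eventually_gt_atTop 0] with L hL
    field_simp
  have h5 := (((h1.const_sub 1).mul (hX.comp ht)).add (h4.const_mul (B ^ 2 / D))).sub
    (h2.const_mul (B ^ 2 / D * ℓ))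
  have h6 := h5.add (h3.const_mul B)
  have e : (1 - 0) * X + B ^ 2 / D * 0 - B ^ 2 / D * ℓ * 0 + B * ℓ = X + B * ℓ := by ring
  rw [e] at h6
  refine h6.congr' ?_
  filter_upwards [ht.eventually_gt_atTop 0] with L hL
  simp only [Function.comp_apply]
  field_simp
  ring

theorem hasExpansionAtZero_of_tendsto {n : ℕ} {m β D B K X ℓ c a : ℝ} {W f : ℝ → ℝ}
    (hβ : β ≠ 0) (hDpos : 0 < D)
    (hD : D = 2 * ((n : ℝ) - 1) * (n - 2 - n * m) / (1 - m))
    (hB : B / D = ((n : ℝ) - 2 - (n + 2) * m) / (2 * ((n : ℝ) - 2 - n * m)))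
    (hX : Tendsto (fun s => s * (W s - D * s - B * log s - K) - B ^ 2 / D * log s) atTop (𝓝 X))
    (hf : ∀ r, 0 < r → f r ^ (1 - m) = W (log r⁻¹ + ℓ) / (|β| * r ^ 2))
    (hc : c = K / D + ℓ) (ha : a = X / D + B / D * ℓ) :
    HasExpansionAtZero n m β c a f := by
  set b := B / D with hb
  have hL : Tendsto (fun r : ℝ => log r⁻¹) (𝓝[>] 0) atTop :=
    tendsto_log_atTop.comp tendsto_inv_nhdsGT_zero
  set ε : ℝ → ℝ := fun r => W (log r⁻¹ + ℓ) / D - (log r⁻¹ + b * log (log r⁻¹) + c + a / log r⁻¹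
    + b ^ 2 * (log (log r⁻¹) / log r⁻¹)) with hε
  refine ⟨ε, (isLittleO_iff_tendsto' ?_).2 ?_, ?_⟩
  · filter_upwards [hL.eventually_gt_atTop 0] with r hr h0
    exact absurd h0 (one_div_pos.2 hr).ne'
  · have h1 := (((tendsto_shifted_expansion hX ℓ).div_const D).sub_const a).comp hL
    have e1 : (X + B * ℓ) / D - a = 0 := by rw [ha, hb]; ring
    rw [e1] at h1
    refine h1.congr' ?_
    filter_upwards [hL.eventually_gt_atTop 0] with r hr
    simp only [Function.comp_apply, hε, hb, hc]
    generalize log r⁻¹ = L at hr ⊢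
    field_simp
    ring
  · filter_upwards [self_mem_nhdsWithin] with r hr
    have hr0 : 0 < r := hr
    have e1 : ((n : ℝ) - 2 - (n + 2) * m) ^ 2 / (4 * ((n : ℝ) - 2 - n * m) ^ 2) = b ^ 2 := by
      rw [hB, div_pow]; ring
    have e2 : 2 * ((n : ℝ) - 1) * (n - 2 - n * m) / ((1 - m) * |β| * r ^ 2)
        = D / (|β| * r ^ 2) := by
      rw [hD, div_div, mul_assoc (1 - m)]
    rw [hf r hr0, e1, e2, ← hB]
    have e3 : log r⁻¹ + b * log (log r⁻¹) + c + a / log r⁻¹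
        + b ^ 2 * (log (log r⁻¹) / log r⁻¹) + ε r = W (log r⁻¹ + ℓ) / D := by
      simp only [hε]; ring
    rw [e3]
    field_simp

section Parameters

variable {n : ℕ} {m : ℝ}

lemma lt_one_of_lt (hn : 3 ≤ n) (hm1 : m < ((n : ℝ) - 2) / n) :
    m < 1 ∧ 0 < (n : ℝ) - 2 - n * m := by
  have hn' : (3 : ℝ) ≤ n := by exact_mod_cast hn
  rw [lt_div_iff₀ (by linarith)] at hm1
  constructor <;> nlinarith

lemma gamma1_eq (hm0 : 0 < m) (hm1 : m < 1) :
    gamma1 n m = ((n : ℝ) - 2 - n * m) / (m * (1 - m)) := by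
  have : 1 - m ≠ 0 := by linarith
  rw [gamma1]
  field_simp
  ring

lemma emdenParams_inverted (hn : 3 ≤ n) (hm0 : 0 < m) (hm1 : m < 1) :
    EmdenParams n m (2 * m / (1 - m)) (((n : ℝ) - 2 - n * m) / (1 - m))
      (((n : ℝ) - 2) / m - n - 2) 1 (gamma1 n m) 1 1 1 := by
  have hn' : (3 : ℝ) ≤ n := by exact_mod_cast hn
  have h1m : 1 - m ≠ 0 := by linarith
  refine ⟨by linarith, hm0, one_pos, one_pos, by norm_num, by simp, ?_, ?_, ?_⟩ <;>
  · rw [gamma1_eq hm0 hm1]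
    field_simp
    ring

/-- The exponent of `μ = |β|^{1/(1-m)}` normalizes the coefficient of `(V^p)'` to `m/(n-1)`. -/
lemma emdenParams_profile (hn : 3 ≤ n) (hm0 : 0 < m) (hm1 : m < 1) {β lam : ℝ} (hβ : β < 0)
    (hlam : 0 < lam) :
    EmdenParams n m (2 * m / (1 - m)) (((n : ℝ) - 2 - n * m) / (1 - m))
      0 β (2 / (1 - m)) ((-β) ^ (1 / (1 - m))) lam (-1) := by
  have hn' : (3 : ℝ) ≤ n := by exact_mod_cast hn
  have h1m : 1 - m ≠ 0 := by linarith
  have hβ' : 0 < -β := by linarith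
  refine ⟨by linarith, hm0, rpow_pos_of_pos hβ' _, hlam, by norm_num, ?_, ?_, ?_, ?_⟩
  · rw [← rpow_mul hβ'.le, neg_one_mul]
    nth_rewrite 1 [← rpow_one (-β)]
    rw [← rpow_add hβ']
    congr 1
    field_simp
    ring
  · field_simp
    ring
  · field_simp
    ring
  · field_simp
    ring

lemma weightedResidual_inverted (g : ℝ → ℝ) (r : ℝ) :
    weightedResidual n m (((n : ℝ) - 2) / m - n - 2) 1 (gamma1 n m) g r =
      ((n : ℝ) - 1) / m * radialLaplacian n (fun x => g x ^ m) r
      + r ^ (((n : ℝ) - 2) / m - n - 2) * (gamma1 n m * 1 * g r + 1 * r * deriv g r) := by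
  rw [weightedResidual]; ring

lemma weightedResidual_profile (β : ℝ) (f : ℝ → ℝ) (r : ℝ) :
    weightedResidual n m 0 β (2 / (1 - m)) f r =
      ((n : ℝ) - 1) / m * radialLaplacian n (fun x => f x ^ m) r
      + 2 * β / (1 - m) * f r + β * r * deriv f r := by
  rw [weightedResidual, rpow_zero]; ring

lemma tendsto_emden_inverted_iff (hm0 : 0 < m) (hm1 : m < 1) {g : ℝ → ℝ}
    (hg : ∀ r, 0 < r → 0 < g r) :
    Tendsto (fun s => exp (-(((n : ℝ) - 2 - n * m) / (1 - m)) * s)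
      * emden m (gamma1 n m) 1 1 1 g s) atBot (𝓝 1) ↔ Tendsto g (𝓝[>] 0) (𝓝 1) := by
  have h1m : 1 - m ≠ 0 := by linarith
  have hmap : map (fun s => exp s) atBot = 𝓝[>] 0 := map_exp_atBot
  rw [← tendsto_rpow_comp_iff hm0 (fun r hr => (hg r hr).le) exp_pos hmap]
  refine tendsto_congr fun s => ?_
  rw [emden, one_mul, one_mul, one_mul, mul_rpow (rpow_nonneg (exp_pos _).le _)
    (hg _ (exp_pos _)).le, ← exp_mul, ← exp_mul, ← mul_assoc, ← exp_add, gamma1_eq hm0 hm1]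
  have : -(((n : ℝ) - 2 - n * m) / (1 - m)) * s
      + s * (((n : ℝ) - 2 - n * m) / (m * (1 - m))) * m = 0 := by
    field_simp
    ring
  rw [this, exp_zero, one_mul]

/-- The value `λ = (Aμ)^{1/γ₁}` is the one for which the growth constant `A` corresponds to the
normalization of the orbit. -/
lemma tendsto_emden_profile_iff (hm0 : 0 < m) (hm1 : m < 1) (hγ : 0 < (n : ℝ) - 2 - n * m)
    {A μ : ℝ} (hA : 0 < A) (hμ : 0 < μ) {f : ℝ → ℝ} (hf : ∀ r, 0 < r → 0 < f r) :
    Tendsto (fun s => exp (-(((n : ℝ) - 2 - n * m) / (1 - m)) * s)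
      * emden m (2 / (1 - m)) μ ((A * μ) ^ (1 / gamma1 n m)) (-1) f s) atBot (𝓝 1) ↔
    Tendsto (fun r => r ^ (((n : ℝ) - 2) / m) * f r) atTop (𝓝 A) := by
  have h1m : 0 < 1 - m := by linarith
  set κ := ((n : ℝ) - 2 - n * m) / (1 - m) with hκdef
  have hκ : 0 < κ := div_pos hγ h1m
  set lam := (A * μ) ^ (1 / gamma1 n m) with hlamdef
  have hAμ : 0 < A * μ := mul_pos hA hμ
  have hlam : 0 < lam := rpow_pos_of_pos hAμ _
  have hlamκ : lam ^ κ = (A * μ) ^ m := by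
    rw [hlamdef, ← rpow_mul hAμ.le, gamma1_eq hm0 hm1, hκdef]
    congr 1
    field_simp
  have hT : Tendsto (fun r => r ^ (((n : ℝ) - 2) / m) * f r) atTop (𝓝 A) ↔
      Tendsto (fun r => r ^ (((n : ℝ) - 2) / m) * f r / A) atTop (𝓝 1) := by
    constructor
    · intro h
      simpa [hA.ne'] using h.div_const A
    · intro h
      have := h.mul_const A
      rw [one_mul] at this
      exact this.congr fun r => by field_simp
  have hρ : ∀ s, 0 < lam * exp (-1 * s) := fun s => mul_pos hlam (exp_pos _)
  rw [hT, ← tendsto_rpow_comp_iff hm0 (T := fun r => r ^ (((n : ℝ) - 2) / m) * f r / A)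
    (fun r hr => div_nonneg (mul_nonneg (rpow_nonneg hr.le _) (hf r hr).le) hA.le) hρ
    (map_mul_exp_neg_atBot hlam)]
  refine tendsto_congr fun s => ?_
  rw [emden]
  set ρ := lam * exp (-1 * s) with hρdef
  have hρ0 : 0 < ρ := hρ s
  have hfρ := hf ρ hρ0
  have hexp : exp (-κ * s) = ρ ^ κ / (A * μ) ^ m := by
    rw [hρdef, mul_rpow hlam.le (exp_pos _).le, hlamκ, mul_div_cancel_left₀ _
      (rpow_pos_of_pos hAμ m).ne', ← exp_mul]
    ring_nf
  have hsplit : ρ ^ (((n : ℝ) - 2) / m) = ρ ^ (κ / m) * ρ ^ (2 / (1 - m)) := by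
    rw [← rpow_add hρ0, hκdef]
    congr 1
    field_simp
    ring
  have hκm : ρ ^ κ = (ρ ^ (κ / m)) ^ m := by
    rw [← rpow_mul hρ0.le, div_mul_cancel₀ _ hm0.ne']
  have h1 := rpow_pos_of_pos hρ0 (κ / m)
  have h2 := rpow_pos_of_pos hρ0 (2 / (1 - m))
  rw [hexp, hκm, hsplit, ← div_rpow h1.le hAμ.le, ← mul_rpow (by positivity) (by positivity)]
  congr 1
  field_simp

end Parameters

end FastDiffusion

end

theorem theorem1p3 (n : ℕ) (hn : 3 ≤ n) (m : ℝ) (hm0 : 0 < m)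
    (hm1 : m < ((n : ℝ) - 2) / n) :
    ∃ g : ℝ → ℝ, FastDiffusion.IsUniqueInvertedProfile n m 1 1 g ∧
      ∃ K : ℝ, FastDiffusion.IsLimitConstant n m 1 g K ∧
        ∀ β : ℝ, β < 0 →
          (∀ A : ℝ, 0 < A →
            ∃ f : ℝ → ℝ, FastDiffusion.IsUniqueProfile n m β A f ∧
              FastDiffusion.HasExpansionAtZero n m β
                (FastDiffusion.K0 n m K + 1 / FastDiffusion.gamma1 n m * Real.log A
                  + m / ((n : ℝ) - 2 - n * m) * Real.log |β|)
                (FastDiffusion.a3 n m K A (-β)) f) ∧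
          (∃ f₁ : ℝ → ℝ, FastDiffusion.IsUniqueProfile n m β 1 f₁ ∧
            ∀ lam : ℝ, 0 < lam →
              FastDiffusion.HasExpansionAtZero n m β
                (FastDiffusion.K0 n m K - Real.log lam
                  + m / ((n : ℝ) - 2 - n * m) * Real.log |β|)
                (FastDiffusion.a3 n m K (lam ^ (-FastDiffusion.gamma1 n m)) (-β))
                (FastDiffusion.scaled m lam f₁)) := by
  open FastDiffusion in
  obtain ⟨hm, hγ⟩ := lt_one_of_lt hn hm1
  have hn' : (3 : ℝ) ≤ n := by exact_mod_cast hn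
  have hn1 : 0 < (n : ℝ) - 1 := by linarith
  have h1m : 0 < 1 - m := by linarith
  set a := 2 * m / (1 - m) with hadef
  set κ := ((n : ℝ) - 2 - n * m) / (1 - m) with hκdef
  have ha : 0 < a := by positivity
  have hκ : 0 < κ := by positivity
  have hk : 0 < m / ((n : ℝ) - 1) := by positivity
  have hp : 1 < 1 / m := one_lt_one_div hm0 hm
  have hγ1eq := gamma1_eq (n := n) hm0 hm
  have hγ1 : 0 < gamma1 n m := by rw [hγ1eq]; positivity
  obtain ⟨V, Y, hV⟩ := exists_orbit ha hκ hk hp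
  set D := 2 * ((n : ℝ) - 1) * (n - 2 - n * m) / (1 - m) with hD
  set B := ((n : ℝ) - 1) * (n - 2 - (n + 2) * m) / (1 - m) with hB
  have hDpos : 0 < D := by positivity
  have hBD : B / D = ((n : ℝ) - 2 - (n + 2) * m) / (2 * ((n : ℝ) - 2 - n * m)) := by
    rw [hB, hD]; field_simp
  obtain ⟨K, hK, hX⟩ := hV.exists_expansion (D := D) (B := B) ha hκ hk hp
    (by rw [hD, hadef, hκdef]; field_simp)
    (by rw [hB, hadef, hκdef]; field_simp; ring)
  set X := B * K / D - (1 / m - 2) / ((1 / m - 1) * (m / ((n : ℝ) - 1) * (1 / m))) with hXdef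
  have hXD : X / D = a1 n m K := by
    have h1 : 1 / m - 1 = (1 - m) / m := by field_simp
    rw [hXdef, h1, a1, a2, hB, hD]
    field_simp
    ring
  have hKD : K / D = K0 n m K := by
    rw [hD, K0]; field_simp
  have pg := emdenParams_inverted hn hm0 hm
  set g := invEmden m (gamma1 n m) 1 1 1 V with hg
  have hgpos : ∀ r, 0 < r → 0 < g r := fun r hr => pg.invEmden_pos hV.pos hr
  have hgV : emden m (gamma1 n m) 1 1 1 g = V := funext (pg.emden_invEmden hV.pos)
  have profile : ∀ β A : ℝ, β < 0 → 0 < A →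
      IsUniqueProfile n m β A (invEmden m (2 / (1 - m)) ((-β) ^ (1 / (1 - m)))
        ((A * (-β) ^ (1 / (1 - m))) ^ (1 / gamma1 n m)) (-1) V) := by
    intro β A hβ hA
    have hβ' : 0 < -β := by linarith
    have hμ : 0 < (-β) ^ (1 / (1 - m)) := rpow_pos_of_pos hβ' _
    have pf := emdenParams_profile hn hm0 hm hβ
      (rpow_pos_of_pos (mul_pos hA hμ) (1 / gamma1 n m))
    refine ⟨⟨pf.contDiffOn_invEmden hV.pos hV.contDiff, fun r hr => pf.invEmden_pos hV.pos hr,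
      fun r hr => ?_, ?_⟩, fun f' hf' => ?_⟩
    · rw [← weightedResidual_profile]
      exact pf.weightedResidual_invEmden hV hr
    · rw [← tendsto_emden_profile_iff hm0 hm hγ hA hμ fun r hr => pf.invEmden_pos hV.pos hr,
        funext (pf.emden_invEmden hV.pos)]
      exact hV.tendsto_fst
    · exact pf.eqOn_invEmden ha hκ hm hV hf'.pos hf'.smooth
        (fun r hr => by rw [weightedResidual_profile]; exact hf'.ode r hr)
        ((tendsto_emden_profile_iff hm0 hm hγ hA hμ hf'.pos).2 hf'.growth)
  -- `f(r)^{1-m} = W(log r⁻¹ + log λ)/(|β|r²)` with `W = V^{p-1}`.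
  have power : ∀ β lam r : ℝ, β < 0 → 0 < lam → 0 < r →
      invEmden m (2 / (1 - m)) ((-β) ^ (1 / (1 - m))) lam (-1) V r ^ (1 - m)
        = V (log r⁻¹ + log lam) ^ (1 / m - 1) / (|β| * r ^ 2) := by
    intro β lam r hβ hlam hr
    have hβ' : 0 < -β := by linarith
    have hμ : 0 < (-β) ^ (1 / (1 - m)) := rpow_pos_of_pos hβ' _
    have hVp := rpow_pos_of_pos (hV.pos (-1 * log (r / lam))) (1 / m)
    have hrp := rpow_pos_of_pos hr (-(2 / (1 - m)))
    rw [invEmden, mul_rpow (by positivity) hVp.le, mul_rpow (by positivity) hrp.le,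
      inv_rpow hμ.le, ← rpow_mul hβ'.le, ← rpow_mul hr.le, ← rpow_mul (hV.pos _).le,
      one_div_mul_cancel h1m.ne', rpow_one, neg_mul, div_mul_cancel₀ _ h1m.ne', rpow_neg hr.le,
      rpow_two, abs_of_neg hβ, log_div hr.ne' hlam.ne', log_inv,
      show -1 * (log r - log lam) = -log r + log lam by ring,
      show 1 / m * (1 - m) = 1 / m - 1 by field_simp]
    field_simp
  have hlogβ : ∀ β : ℝ, β < 0 → 1 / gamma1 n m * (1 / (1 - m) * log (-β))
      = m / ((n : ℝ) - 2 - n * m) * log |β| := fun β hβ => by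
    rw [abs_of_neg hβ, hγ1eq]; field_simp
  refine ⟨g, ⟨⟨pg.contDiffOn_invEmden hV.pos hV.contDiff, hgpos, fun r hr => ?_, ?_⟩,
    fun g' hg' => ?_⟩, K, ?_, fun β hβ => ⟨fun A hA => ⟨_, profile β A hβ hA, ?_⟩,
    _, profile β 1 hβ one_pos, fun lam hlam => ?_⟩⟩
  · rw [← weightedResidual_inverted]
    exact pg.weightedResidual_invEmden hV hr
  · rw [← tendsto_emden_inverted_iff hm0 hm hgpos, hgV]
    exact hV.tendsto_fst
  · exact pg.eqOn_invEmden ha hκ hm hV hg'.pos hg'.smooth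
      (fun r hr => by rw [weightedResidual_inverted]; exact hg'.ode r hr)
      ((tendsto_emden_inverted_iff hm0 hm hg'.pos).2 hg'.initial)
  · refine hK.congr fun s => ?_
    -- `wTilde` is exactly `W = V^{p-1}`.
    have e1 : wTilde n m g s = V s ^ (1 / m - 1) := by
      have h1 : 0 < exp s ^ gamma1 n m * g (exp s) :=
        mul_pos (rpow_pos_of_pos (exp_pos _) _) (hgpos _ (exp_pos _))
      rw [← hgV, emden, one_mul, one_mul, one_mul, ← rpow_mul h1.le, wTilde,
        show m * (1 / m - 1) = 1 - m by field_simp,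
        mul_rpow (rpow_pos_of_pos (exp_pos _) _).le (hgpos _ (exp_pos _)).le,
        ← rpow_mul (exp_pos _).le, mul_comm (1 - m)]
    rw [h1Fun, hFun, e1, mul_one]
  · have hβ' : 0 < -β := by linarith
    have hμ : 0 < (-β) ^ (1 / (1 - m)) := rpow_pos_of_pos hβ' _
    have hAμ : 0 < A * (-β) ^ (1 / (1 - m)) := mul_pos hA hμ
    refine hasExpansionAtZero_of_tendsto hβ.ne hDpos hD hBD hX
      (fun r hr => power β _ r hβ (rpow_pos_of_pos hAμ _) hr) ?_ ?_
    · rw [hKD, log_rpow hAμ, log_mul hA.ne' hμ.ne', log_rpow hβ', mul_add, hlogβ β hβ]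
      ring
    · rw [hXD, log_rpow hAμ, a3, hBD, div_mul_eq_div_div]
      ring
  · have hβ' : 0 < -β := by linarith
    have hμ : 0 < (-β) ^ (1 / (1 - m)) := rpow_pos_of_pos hβ' _
    have hμ1 : 0 < 1 * (-β) ^ (1 / (1 - m)) := by linarith
    have hlamγ : 0 < lam ^ (-gamma1 n m) := rpow_pos_of_pos hlam _
    set lam₁ := (1 * (-β) ^ (1 / (1 - m))) ^ (1 / gamma1 n m) with hlam₁
    have hlam₁pos : 0 < lam₁ := rpow_pos_of_pos hμ1 _
    have hlog₁ : log lam₁ = m / ((n : ℝ) - 2 - n * m) * log |β| := by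
      rw [hlam₁, log_rpow hμ1, one_mul, log_rpow hβ', hlogβ β hβ]
    refine hasExpansionAtZero_of_tendsto (ℓ := log lam₁ - log lam) hβ.ne hDpos hD hBD hX
      (fun r hr => ?_) ?_ ?_
    · have hlr := mul_pos hlam hr
      have pf := emdenParams_profile hn hm0 hm hβ hlam₁pos
      rw [scaled, mul_rpow (rpow_pos_of_pos hlam _).le (pf.invEmden_pos hV.pos hlr).le,
        power β lam₁ _ hβ hlam₁pos hlr, ← rpow_mul hlam.le, div_mul_cancel₀ _ h1m.ne', rpow_two,
        log_inv, log_inv, log_mul hlam.ne' hr.ne',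
        show -(log lam + log r) + log lam₁ = -log r + (log lam₁ - log lam) by ring]
      field_simp
    · rw [hKD, hlog₁]
      ring
    · rw [hXD, a3, log_mul hlamγ.ne' hμ.ne', log_rpow hlam, log_rpow hβ', hBD, hlog₁,
        ← hlogβ β hβ]
      field_simp
      ring
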